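/- An $\alpha$-stationary surface is a connected surface $\Sigma$ smoothly immersed in $\mathbb R^3\setminus\{0\}$ whose mean curvature $H$ (the sum of the principal curvatures with respect to the unit normal $\nu$, so that a sphere of radius $r$ has $H=2/r$ for the inward normal) satisfies $H(p)=\alpha\,\langle \nu(p),p\rangle/|p|^{2}$ for all $p\in\Sigma$. It spans a curve $\Gamma$ if its boundary $\partial\Sigma$ is mapped onto $\Gamma$ by the immersion. **Theorem.** Let $r_0>0$, let $\mathbb S^2(r_0)\subset\mathbb R^3$ be the sphere of radius $r_0$ centred at $0$, and let $\Gamma$ be a circle (of positive radius) contained in $\mathbb S^2(r_0)$. Then the closed spherical caps of $\mathbb S^2(r_0)$ bounded by $\Gamma$ are the only compact $-2$-stationary surfaces spanning $\Gamma$. That is: (i) if $\Sigma$ is a compact $-2$-stationary surface (with boundary) spanning $\Gamma$, then its immersion is injective and its image is one of the closed spherical caps of $\mathbb S^2(r_0)$ bounded by $\Gamma$; (ii) each closed spherical cap of $\mathbb S^2(r_0)$ bounded by $\Gamma$ is the image of an injectively immersed compact $-2$-stationary surface spanning $\Gamma$. -/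

import Mathlib

open scoped Manifold ContDiff

namespace StationarySurface

noncomputable section

/-- Euclidean 3-space. -/
abbrev E3 : Type := EuclideanSpace ℝ (Fin 3)

/-- The Euclidean plane of parameters `(u₀, u₁)`. -/
abbrev E2 : Type := EuclideanSpace ℝ (Fin 2)

/-- The `i`-th partial derivative at `x` of a map `X` defined on a subset `S` of the plane.
(For `S` the closed half-plane this is the usual one, one-sided at the edge.) -/
def pderiv (S : Set E2) (X : E2 → E3) (i : Fin 2) (x : E2) : E3 :=
  fderivWithin ℝ X S x (EuclideanSpace.single i 1)

/-- Coefficients `g_ij = ⟨X_i, X_j⟩` of the first fundamental form of a parametrization `X`. -/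
def firstForm (S : Set E2) (X : E2 → E3) (i j : Fin 2) (x : E2) : ℝ :=
  inner ℝ (pderiv S X i x) (pderiv S X j x)

/-- Coefficients `h_ij = ⟨X_ij, ν⟩` of the second fundamental form of a parametrization `X`
with respect to the normal vector `ν`. -/
def secondForm (S : Set E2) (X : E2 → E3) (ν : E3) (i j : Fin 2) (x : E2) : ℝ :=
  inner ℝ (pderiv S (pderiv S X i) j x) ν

/-- The mean curvature of a parametrized surface with respect to the unit normal `ν`: the sum of
the principal curvatures, that is, the trace `(eG - 2fF + gE) / (EG - F²)` of the second
fundamental form with respect to the first. A sphere of radius `r` has mean curvature `2 / r` with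
respect to the inward normal. -/
def meanCurvature (S : Set E2) (X : E2 → E3) (ν : E3) (x : E2) : ℝ :=
  (secondForm S X ν 0 0 x * firstForm S X 1 1 x
      - 2 * secondForm S X ν 0 1 x * firstForm S X 0 1 x
      + secondForm S X ν 1 1 x * firstForm S X 0 0 x) /
    (firstForm S X 0 0 x * firstForm S X 1 1 x - firstForm S X 0 1 x ^ 2)

/-- The local parametrization of the surface `f : M → ℝ³` given by a chart `e` of `M`. -/
def localParam {M : Type*} [TopologicalSpace M] (f : M → E3)
    (e : OpenPartialHomeomorph M (EuclideanHalfSpace 2)) : E2 → E3 :=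
  f ∘ (e.extend (𝓡∂ 2)).symm

/-- `f : M → ℝ³` is a compact (connected, immersed) `α`-stationary surface: `M` is a compact
connected smooth surface, possibly with boundary, `f` is a smooth immersion avoiding the origin,
and the mean curvature satisfies `H(p) = α ⟨ν(p), p⟩ / |p|²`. The equation is invariant under
`ν ↦ -ν`, so it is required, in every local parametrization, for each unit normal vector. -/
structure IsCompactStationary (α : ℝ) {M : Type*} [TopologicalSpace M]
    [ChartedSpace (EuclideanHalfSpace 2) M] (f : M → E3) : Prop where
  isManifold : IsManifold (𝓡∂ 2) ∞ M
  t2Space : T2Space M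
  compactSpace : CompactSpace M
  connectedSpace : ConnectedSpace M
  smooth : ContMDiff (𝓡∂ 2) 𝓘(ℝ, E3) ∞ f
  immersion : ∀ p : M, Function.Injective (mfderiv (𝓡∂ 2) 𝓘(ℝ, E3) f p)
  ne_zero : ∀ p : M, f p ≠ 0
  stationary : ∀ e ∈ IsManifold.maximalAtlas (𝓡∂ 2) ∞ M, ∀ x ∈ (e.extend (𝓡∂ 2)).target,
    ∀ ν : E3, ‖ν‖ = 1 →
      (∀ i : Fin 2, inner ℝ ν (pderiv (Set.range (𝓡∂ 2)) (localParam f e) i x) = 0) →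
      meanCurvature (Set.range (𝓡∂ 2)) (localParam f e) ν x =
        α * (inner ℝ ν (localParam f e x) / ‖localParam f e x‖ ^ 2)

/-- The surface `f : M → ℝ³` spans `Γ`: the boundary of `M` is mapped onto `Γ`. -/
def Spans {M : Type*} [TopologicalSpace M] [ChartedSpace (EuclideanHalfSpace 2) M]
    (f : M → E3) (Γ : Set E3) : Prop :=
  f '' (𝓡∂ 2).boundary M = Γ

/-- `Γ` is a (round, nondegenerate) circle in `ℝ³`, with centre `c` and radius `ρ > 0`, in the
plane through `c` orthogonal to `v`. -/
def IsCircle (Γ : Set E3) : Prop :=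
  ∃ (c v : E3) (ρ : ℝ), v ≠ 0 ∧ 0 < ρ ∧ Γ = {x | dist x c = ρ ∧ inner ℝ v (x - c) = 0}

/-- `C` is one of the closed spherical caps of the sphere of centre `0` and radius `r` bounded by
the circle `Γ`: the part of the sphere on one side of the plane `⟨v, x⟩ = d` that cuts the sphere
along `Γ`. (The other cap is obtained from `-v`, `-d`.) -/
def IsSphericalCap (r : ℝ) (Γ C : Set E3) : Prop :=
  ∃ (v : E3) (d : ℝ), v ≠ 0 ∧ Γ = {x | x ∈ Metric.sphere (0 : E3) r ∧ inner ℝ v x = d} ∧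
    C = {x | x ∈ Metric.sphere (0 : E3) r ∧ d ≤ inner ℝ v x}

end

end StationarySurface

namespace StationarySurface

open Set Filter Topology

/-! ### The strong maximum principle for linear elliptic operators in the plane -/

/-! For an immersion `X` with `H = -2⟨ν, X⟩ / |X|²`, the Laplacian of `|X|²` on the surface is `4 +
2H⟨ν, X⟩ = 4|Xᵀ|² / |X|²`, where `Xᵀ` is the tangential part. Since `∇|X|² = 2Xᵀ`, this says that
`log |X|` is harmonic. So `|X|²` solves a linear elliptic equation without zero order term once one
gradient factor is frozen as a coefficient (`trace_identity`). Hopf's strong maximum principle,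
applied to `|X|²` and to `-|X|²`, forces `|X|` to be constant as soon as it is constant on a
nonempty boundary (`IsCompactStationary.norm_eq`): the surface lies in the sphere.

What remains is topology. In the interior the immersion is locally a homeomorphism onto open pieces
of the sphere. At a boundary point the circle cuts the sphere into two sides, the conormal is
transversal to the plane of the circle, and the surface locally fills exactly one side
(`IsLocalModel.one_sided`). Restricted to the closure of the part of `M` lying strictly on that
side, `f` is a local homeomorphism from a compact space to a closed cap, hence a covering. The cap
is a disc, so the covering has a section through a given boundary point. The section sends the
bounding circle into `∂M`, because "lying in `∂M`" is a clopen condition along it; therefore its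
image is open as well as compact in `M`, and it is all of the connected surface
(`IsSphericalDomain.injective_and_range_of_mem`).

Conversely, on a surface in the sphere every normal vector is a multiple `sX`, and `⟨X_ij, X⟩ =
-g_ij` gives `H = -2s`, which is the equation (`meanCurvature_of_norm_eq`). A cap becomes a surface
with boundary through stereographic projections from poles on its bounding circle, which straighten
it to a half plane; two such poles cover it. -/

/-- `u` is differentiable at `x` with partial derivatives `p` and `q`. -/
def HasGradAt (u : E2 → ℝ) (p q : ℝ) (x : E2) : Prop :=
  HasFDerivAt u (p • (EuclideanSpace.proj 0 : E2 →L[ℝ] ℝ) + q • EuclideanSpace.proj 1) x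

namespace HasGradAt

variable {u v : E2 → ℝ} {p q p' q' : ℝ} {x : E2}

lemma hasDerivAt_line (h : HasGradAt u p q x) (ξ y : E2) (t : ℝ) (hx : y + t • ξ = x) :
    HasDerivAt (fun τ : ℝ => u (y + τ • ξ)) (p * ξ 0 + q * ξ 1) t := by
  have h1 : HasDerivAt (fun τ : ℝ => y + τ • ξ) ξ t := by
    simpa using ((hasDerivAt_id t).smul_const ξ).const_add y
  subst hx
  have h2 := HasFDerivAt.comp_hasDerivAt (f := fun τ : ℝ => y + τ • ξ) t h h1
  exact h2.congr_deriv (by simp)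

lemma add_const_smul (hu : HasGradAt u p q x) (hv : HasGradAt v p' q' x) (ε : ℝ) :
    HasGradAt (fun y => u y + ε * v y) (p + ε * p') (q + ε * q') x := by
  unfold HasGradAt at *
  refine (hu.add (hv.const_mul ε)).congr_fderiv ?_
  ext ξ
  simp; ring

end HasGradAt

/-- If `c > 0`, the second derivative test makes `0` a local minimum too, so `g` is locally constant
and `c = 0`. -/
lemma second_deriv_nonpos_of_isLocalMax {g g' : ℝ → ℝ} {c : ℝ} (hg : IsLocalMax g 0)
    (h1 : ∀ᶠ t in 𝓝 (0 : ℝ), HasDerivAt g (g' t) t) (h2 : HasDerivAt g' c 0) : c ≤ 0 := by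
  by_contra! hc
  have hd : deriv g =ᶠ[𝓝 0] g' := h1.mono fun t ht => ht.deriv
  have h0 : deriv g 0 = 0 := hg.deriv_eq_zero
  have hdd : deriv (deriv g) 0 = c := by rw [hd.deriv_eq, h2.deriv]
  have hmin := isLocalMin_of_deriv_deriv_pos (by rw [hdd]; exact hc) h0
    h1.self_of_nhds.continuousAt
  have hconst : g =ᶠ[𝓝 0] fun _ => g 0 := by
    filter_upwards [hg, hmin] with t ht ht' using le_antisymm ht ht'
  have : deriv g =ᶠ[𝓝 0] fun _ => 0 := by
    have := hconst.deriv
    simpa using this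
  rw [this.deriv_eq, deriv_const] at hdd
  exact hc.ne hdd

/-- Restriction to lines through `x` reduces this to one variable. Only the symmetric part `b + c`
of the mixed terms is seen, so no symmetry of second derivatives is needed. -/
lemma hessian_test {v p q : E2 → ℝ} {a b c d : ℝ} {x : E2} (hv : IsLocalMax v x)
    (h : ∀ᶠ y in 𝓝 x, HasGradAt v (p y) (q y) y) (hp : HasGradAt p a b x)
    (hq : HasGradAt q c d x) :
    p x = 0 ∧ q x = 0 ∧ ∀ s t : ℝ, a * s ^ 2 + (b + c) * (s * t) + d * t ^ 2 ≤ 0 := by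
  have h0 := h.self_of_nhds
  have hz := hv.hasFDerivAt_eq_zero h0
  refine ⟨?_, ?_, fun s t => ?_⟩
  · simpa using congrArg (fun l => l (EuclideanSpace.single 0 1)) hz
  · simpa using congrArg (fun l => l (EuclideanSpace.single 1 1)) hz
  · set ξ : E2 := !₂[s, t] with hξ
    have hcont : Tendsto (fun τ : ℝ => x + τ • ξ) (𝓝 0) (𝓝 x) := by
      have : Continuous fun τ : ℝ => x + τ • ξ := by fun_prop
      simpa using this.tendsto 0
    have hmax : IsLocalMax (fun τ : ℝ => v (x + τ • ξ)) 0 := by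
      have := hcont.eventually hv
      simpa [IsLocalMax, IsMaxFilter] using this
    have h1 : ∀ᶠ τ in 𝓝 (0 : ℝ), HasDerivAt (fun τ : ℝ => v (x + τ • ξ))
        (p (x + τ • ξ) * s + q (x + τ • ξ) * t) τ := by
      filter_upwards [hcont.eventually h] with τ hτ
      simpa [hξ] using hτ.hasDerivAt_line ξ x τ rfl
    have h2 := ((hp.hasDerivAt_line ξ x 0 (by simp)).mul_const s).add
      ((hq.hasDerivAt_line ξ x 0 (by simp)).mul_const t)
    have := second_deriv_nonpos_of_isLocalMax hmax h1 h2
    simp [hξ] at this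
    nlinarith [this]

/-- `a` times the trace is the value of the form at `(a, b)` plus the determinant times its value at
`(0, 1)`. -/
lemma trace_nonpos {a b c A B D : ℝ} (ha : 0 < a) (hdet : 0 < a * c - b ^ 2)
    (h : ∀ s t : ℝ, A * s ^ 2 + B * (s * t) + D * t ^ 2 ≤ 0) : a * A + b * B + c * D ≤ 0 := by
  have h1 := h a b
  have h2 := h 0 1
  have : a * (a * A + b * B + c * D) ≤ 0 := by nlinarith
  by_contra! hc
  nlinarith [mul_pos ha hc]

/-- A second order operator `a ∂₀₀ + 2 b ∂₀₁ + c ∂₁₁ + β ∂₀ + γ ∂₁` with continuous coefficients,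
elliptic on `Ω`. -/
structure EllipticOn (Ω : Set E2) (a b c β γ : E2 → ℝ) : Prop where
  isOpen : IsOpen Ω
  cont_a : ContinuousOn a Ω
  cont_b : ContinuousOn b Ω
  cont_c : ContinuousOn c Ω
  cont_β : ContinuousOn β Ω
  cont_γ : ContinuousOn γ Ω
  pos : ∀ x ∈ Ω, 0 < a x
  det_pos : ∀ x ∈ Ω, 0 < a x * c x - b x ^ 2

/-- `u` is a twice differentiable subsolution, with first derivatives `p`, `q`. -/
structure SubsolutionOn (Ω : Set E2) (a b c β γ u p q p₀ p₁ q₀ q₁ : E2 → ℝ) : Prop where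
  grad : ∀ x ∈ Ω, HasGradAt u (p x) (q x) x
  grad_p : ∀ x ∈ Ω, HasGradAt p (p₀ x) (p₁ x) x
  grad_q : ∀ x ∈ Ω, HasGradAt q (q₀ x) (q₁ x) x
  nonneg : ∀ x ∈ Ω, 0 ≤ a x * p₀ x + b x * (p₁ x + q₀ x) + c x * q₁ x + β x * p x + γ x * q x

lemma hasGradAt_coord (i : Fin 2) (x : E2) :
    HasFDerivAt (fun y : E2 => y i) (EuclideanSpace.proj i : E2 →L[ℝ] ℝ) x :=
  (EuclideanSpace.proj i : E2 →L[ℝ] ℝ).hasFDerivAt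

/-- The Gaussian barrier of the Hopf lemma. -/
noncomputable def barrier (k : ℝ) (y x : E2) : ℝ :=
  Real.exp (-k * ((x 0 - y 0) ^ 2 + (x 1 - y 1) ^ 2))

lemma hasGradAt_barrier (k : ℝ) (y x : E2) :
    HasGradAt (barrier k y) (-2 * k * (x 0 - y 0) * barrier k y x)
      (-2 * k * (x 1 - y 1) * barrier k y x) x := by
  have h0 := (hasGradAt_coord 0 x).sub_const (y 0)
  have h1 := (hasGradAt_coord 1 x).sub_const (y 1)
  have := (((h0.pow 2).add (h1.pow 2)).const_mul (-k)).exp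
  refine this.congr_fderiv ?_
  ext ξ
  simp [barrier]; ring

lemma hasGradAt_barrier_grad (k : ℝ) (y x : E2) (i : Fin 2) :
    HasGradAt (fun x => -2 * k * (x i - y i) * barrier k y x)
      ((4 * k ^ 2 * (x i - y i) * (x 0 - y 0) - 2 * k * (if i = 0 then 1 else 0)) * barrier k y x)
      ((4 * k ^ 2 * (x i - y i) * (x 1 - y 1) - 2 * k * (if i = 1 then 1 else 0)) * barrier k y x)
      x := by
  have h0 := ((hasGradAt_coord i x).sub_const (y i)).const_mul (-2 * k)
  have := h0.mul (hasGradAt_barrier k y x)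
  refine this.congr_fderiv ?_
  ext ξ
  fin_cases i <;> simp <;> ring

lemma dist_sq_eq (x y : E2) : dist x y ^ 2 = (x 0 - y 0) ^ 2 + (x 1 - y 1) ^ 2 := by
  rw [EuclideanSpace.dist_eq, Real.sq_sqrt (by positivity)]
  simp [Fin.sum_univ_two, Real.dist_eq, sq_abs]

lemma barrier_lt_iff {k : ℝ} (hk : 0 < k) {y x : E2} {R : ℝ} (hR : 0 < R) :
    barrier k y x < Real.exp (-k * R ^ 2) ↔ R < dist x y := by
  rw [barrier, ← dist_sq_eq, Real.exp_lt_exp, ← sq_lt_sq₀ hR.le dist_nonneg]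
  constructor <;> intro h <;> nlinarith

lemma quadratic_pos {a b c X Y : ℝ} (ha : 0 < a) (hdet : 0 < a * c - b ^ 2) (h : X ≠ 0 ∨ Y ≠ 0) :
    0 < a * X ^ 2 + 2 * b * (X * Y) + c * Y ^ 2 := by
  have : a * (a * X ^ 2 + 2 * b * (X * Y) + c * Y ^ 2)
      = (a * X + b * Y) ^ 2 + (a * c - b ^ 2) * Y ^ 2 := by ring
  have hpos : 0 < (a * X + b * Y) ^ 2 + (a * c - b ^ 2) * Y ^ 2 := by
    by_cases hY : Y = 0
    · subst hY
      have hX : X ≠ 0 := by simpa using h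
      have : a * X + b * 0 ≠ 0 := by simp [hX, ha.ne']
      positivity
    · positivity
  rw [← this] at hpos
  exact pos_of_mul_pos_right hpos ha.le

section Hopf

variable {Ω : Set E2} {a b c β γ u p q p₀ p₁ q₀ q₁ : E2 → ℝ}

lemma SubsolutionOn.continuousOn (h : SubsolutionOn Ω a b c β γ u p q p₀ p₁ q₀ q₁) :
    ContinuousOn u Ω := fun x hx =>
  (HasFDerivAt.continuousAt (h.grad x hx)).continuousWithinAt

/-- A subsolution cannot attain its maximum at exactly one point of a closed disc, on its
boundary circle, if the disc lies in the domain and the maximum is a maximum over the domain. -/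
lemma SubsolutionOn.not_touching (hE : EllipticOn Ω a b c β γ)
    (hS : SubsolutionOn Ω a b c β γ u p q p₀ p₁ q₀ q₁) {m : ℝ} (hm : ∀ x ∈ Ω, u x ≤ m)
    {y z : E2} {R : ℝ} (hR : 0 < R) (hzΩ : z ∈ Ω) (hzy : dist z y = R) (huz : u z = m)
    (hlt : ∀ x ∈ Metric.closedBall y R, x ≠ z → x ∈ Ω → u x < m) : False := by
  obtain ⟨ρ₀, hρ₀, hball⟩ := Metric.isOpen_iff.1 hE.isOpen z hzΩ
  -- Small enough for the ball around `z` to stay in `Ω` and to miss the centre `y`, where the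
  -- gradient of the barrier vanishes.
  set ρ := min (ρ₀ / 2) (R / 2) with hρ
  have hρpos : 0 < ρ := by positivity
  have hρR : ρ < R := lt_of_le_of_lt (min_le_right _ _) (by linarith)
  have hBΩ : Metric.closedBall z ρ ⊆ Ω :=
    (Metric.closedBall_subset_ball (lt_of_le_of_lt (min_le_left _ _) (by linarith))).trans hball
  have hBc : IsCompact (Metric.closedBall z ρ) := isCompact_closedBall z ρ
  have hne : ∀ x ∈ Metric.closedBall z ρ, x 0 - y 0 ≠ 0 ∨ x 1 - y 1 ≠ 0 := by
    intro x hx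
    by_contra! h
    have : dist x y ^ 2 = 0 := by rw [dist_sq_eq, h.1, h.2]; norm_num
    have hxy : dist x y = 0 := by simpa using this
    have := dist_triangle z x y
    rw [Metric.mem_closedBall, dist_comm] at hx
    linarith
  -- With these, the operator applied to the barrier is `2k (2k Q - T)` times the barrier. As `Q >
  -- 0`, a large `k` makes it a strict subsolution.
  set Q : E2 → ℝ := fun x =>
    a x * (x 0 - y 0) ^ 2 + 2 * b x * ((x 0 - y 0) * (x 1 - y 1)) + c x * (x 1 - y 1) ^ 2 with hQ
  set T : E2 → ℝ := fun x => a x + c x + β x * (x 0 - y 0) + γ x * (x 1 - y 1) with hT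
  have hQpos : ∀ x ∈ Metric.closedBall z ρ, 0 < Q x := fun x hx =>
    quadratic_pos (hE.pos x (hBΩ hx)) (hE.det_pos x (hBΩ hx)) (hne x hx)
  have ca := hE.cont_a.mono hBΩ
  have cb := hE.cont_b.mono hBΩ
  have cc := hE.cont_c.mono hBΩ
  have cβ := hE.cont_β.mono hBΩ
  have cγ := hE.cont_γ.mono hBΩ
  have hTQ : ContinuousOn (fun x => T x / Q x) (Metric.closedBall z ρ) := by
    refine ContinuousOn.div ?_ ?_ fun x hx => (hQpos x hx).ne'
    · simp only [hT]; fun_prop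
    · simp only [hQ]; fun_prop
  obtain ⟨k₀, hk₀⟩ := hBc.bddAbove_image hTQ
  set k := |k₀| + 1 with hk
  have hkpos : 0 < k := by positivity
  have hkey : ∀ x ∈ Metric.closedBall z ρ, 0 < 2 * k * Q x - T x := by
    intro x hx
    have h1 : T x / Q x ≤ k₀ := hk₀ ⟨x, hx, rfl⟩
    rw [div_le_iff₀ (hQpos x hx)] at h1
    have h2 : k₀ < 2 * k := by have := le_abs_self k₀; linarith [abs_nonneg k₀]
    nlinarith [mul_lt_mul_of_pos_right h2 (hQpos x hx)]
  obtain ⟨δ, hδ, hδu⟩ : ∃ δ > 0, ∀ x ∈ Metric.sphere z ρ ∩ Metric.closedBall y R, u x ≤ m - δ := by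
    have hKc : IsCompact (Metric.sphere z ρ ∩ Metric.closedBall y R) :=
      (isCompact_sphere z ρ).inter_right Metric.isClosed_closedBall
    have hKΩ : Metric.sphere z ρ ∩ Metric.closedBall y R ⊆ Ω :=
      inter_subset_left.trans (Metric.sphere_subset_closedBall.trans hBΩ)
    rcases (Metric.sphere z ρ ∩ Metric.closedBall y R).eq_empty_or_nonempty with h | h
    · exact ⟨1, one_pos, by simp [h]⟩
    · obtain ⟨x, hx, hmax⟩ := hKc.exists_isMaxOn h (hS.continuousOn.mono hKΩ)
      have hxz : x ≠ z := by
        rintro rfl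
        have := hx.1
        simp at this
        linarith
      have := hlt x hx.2 hxz (hKΩ hx)
      exact ⟨m - u x, by linarith, fun w hw => by have := hmax hw; simp at this; linarith⟩
  -- The barrier is at most `1`, so adding `ε` times it cannot use up the gap `δ` on the part of the
  -- small circle inside the disc. Outside the disc the barrier is below its value at `z`, so no gap
  -- is needed there.
  set ε := δ / 2 with hε
  have hεpos : 0 < ε := by positivity
  set v : E2 → ℝ := fun x => u x + ε * barrier k y x with hv
  set m' := m + ε * Real.exp (-k * R ^ 2) with hm'
  have hvz : v z = m' := by
    simp only [hv, hm', huz, barrier, ← dist_sq_eq, hzy]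
  have hvs : ∀ x ∈ Metric.sphere z ρ, v x < m' := by
    intro x hx
    by_cases hxR : x ∈ Metric.closedBall y R
    · have h1 := hδu x ⟨hx, hxR⟩
      have h2 : barrier k y x ≤ 1 := by
        rw [barrier, Real.exp_le_one_iff]
        have : 0 ≤ (x 0 - y 0) ^ 2 + (x 1 - y 1) ^ 2 := by positivity
        nlinarith
      have h3 : 0 < Real.exp (-k * R ^ 2) := Real.exp_pos _
      simp only [hv, hm']
      nlinarith [mul_pos hεpos h3]
    · have h1 := hm x (hBΩ (Metric.sphere_subset_closedBall hx))
      have h2 := (barrier_lt_iff hkpos hR).2 (by simpa using hxR : R < dist x y)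
      simp only [hv, hm']
      nlinarith
  have hvcont : ContinuousOn v (Metric.closedBall z ρ) :=
    (hS.continuousOn.mono hBΩ).add (continuousOn_const.mul fun x _ =>
      (HasFDerivAt.continuousAt (hasGradAt_barrier k y x)).continuousWithinAt)
  obtain ⟨x, hx, hmax⟩ := hBc.exists_isMaxOn ⟨z, Metric.mem_closedBall_self hρpos.le⟩ hvcont
  have hxm : m' ≤ v x := hvz ▸ hmax (Metric.mem_closedBall_self hρpos.le)
  have hxball : x ∈ Metric.ball z ρ := by
    rcases (Metric.mem_closedBall.1 hx).lt_or_eq with h | h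
    · exact h
    · exact absurd hxm (not_le.2 (hvs x h))
  have hnhds : Metric.closedBall z ρ ∈ 𝓝 x :=
    mem_of_superset (Metric.isOpen_ball.mem_nhds hxball) Metric.ball_subset_closedBall
  have hloc : IsLocalMax v x := hmax.isLocalMax hnhds
  have hxΩ := hBΩ hx
  have hgrad : ∀ᶠ w in 𝓝 x, HasGradAt v (p w + ε * (-2 * k * (w 0 - y 0) * barrier k y w))
      (q w + ε * (-2 * k * (w 1 - y 1) * barrier k y w)) w := by
    filter_upwards [hnhds] with w hw
    exact (hS.grad w (hBΩ hw)).add_const_smul (hasGradAt_barrier k y w) ε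
  -- At an interior maximum of `v` the operator is nonpositive on `v`, although `v` is a subsolution
  -- plus a positive multiple of a strict one.
  obtain ⟨e1, e2, e3⟩ := hessian_test hloc hgrad
    ((hS.grad_p x hxΩ).add_const_smul (hasGradAt_barrier_grad k y x 0) ε)
    ((hS.grad_q x hxΩ).add_const_smul (hasGradAt_barrier_grad k y x 1) ε)
  have htr := trace_nonpos (hE.pos x hxΩ) (hE.det_pos x hxΩ) e3
  have hsub := hS.nonneg x hxΩ
  have hb : 0 < barrier k y x := Real.exp_pos _
  have hpx : p x = 2 * k * ε * (x 0 - y 0) * barrier k y x := by linarith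
  have hqx : q x = 2 * k * ε * (x 1 - y 1) * barrier k y x := by linarith
  rw [hpx, hqx] at hsub
  have hprod : 0 < 2 * k * ε * barrier k y x * (2 * k * Q x - T x) :=
    mul_pos (by positivity) (hkey x hx)
  simp only [hQ, hT] at hprod
  simp at htr
  linarith

/-- **Strong maximum principle**: a subsolution which attains its maximum at an interior point is
constant near this point. -/
theorem SubsolutionOn.eventually_eq_of_max (hE : EllipticOn Ω a b c β γ)
    (hS : SubsolutionOn Ω a b c β γ u p q p₀ p₁ q₀ q₁) {m : ℝ} (hm : ∀ x ∈ Ω, u x ≤ m)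
    {x₀ : E2} (hx₀ : x₀ ∈ Ω) (hux₀ : u x₀ = m) : ∀ᶠ x in 𝓝 x₀, u x = m := by
  obtain ⟨δ, hδ, hball⟩ := Metric.isOpen_iff.1 hE.isOpen x₀ hx₀
  -- A quarter of the radius: the ball about `y₀` reaching the nearest maximum point then stays
  -- within `δ / 2` of `x₀`.
  filter_upwards [Metric.ball_mem_nhds x₀ (by positivity : 0 < δ / 4)] with y₀ hy₀
  rw [Metric.mem_ball] at hy₀
  by_contra hne
  set B := Metric.closedBall x₀ (δ / 2) with hB
  have hBΩ : B ⊆ Ω := (Metric.closedBall_subset_ball (by linarith)).trans hball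
  set K := B ∩ u ⁻¹' {m} with hK
  have hKc : IsCompact K := by
    have := (hS.continuousOn.mono hBΩ).preimage_isClosed_of_isClosed Metric.isClosed_closedBall
      (isClosed_singleton (x := m))
    exact (isCompact_closedBall x₀ (δ / 2)).of_isClosed_subset this inter_subset_left
  have hx₀K : x₀ ∈ K := ⟨Metric.mem_closedBall_self (by positivity), hux₀⟩
  obtain ⟨z, hzK, hz⟩ := hKc.exists_infDist_eq_dist ⟨x₀, hx₀K⟩ y₀
  set R₀ := dist y₀ z with hR₀
  have hmin : ∀ x ∈ K, R₀ ≤ dist y₀ x := fun x hx => hz ▸ Metric.infDist_le_dist_of_mem hx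
  have hR₀pos : 0 < R₀ := by
    rw [hR₀, dist_pos]
    rintro rfl
    exact hne hzK.2
  have hR₀le : R₀ < δ / 4 := (hmin x₀ hx₀K).trans_lt hy₀
  -- The disc with diameter from `y₀` to `z` is internally tangent at `z` to the largest disc about
  -- `y₀` without maximum points in its interior. Halving the radius makes `z` the only contact
  -- point.
  set y := midpoint ℝ y₀ z with hy
  have hzy : dist z y = R₀ / 2 := by
    rw [hy, dist_comm, dist_midpoint_right]; simp; ring
  have hyy₀ : dist y y₀ = R₀ / 2 := by
    rw [hy, dist_midpoint_left]; simp; ring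
  refine SubsolutionOn.not_touching hE hS hm (half_pos hR₀pos) (hBΩ hzK.1) hzy hzK.2 ?_
  intro x hx hxz hxΩ
  refine lt_of_le_of_ne (hm x hxΩ) fun hux => hxz ?_
  rw [Metric.mem_closedBall] at hx
  have h1 : dist x y₀ ≤ R₀ := by linarith [dist_triangle x y y₀]
  have hxK : x ∈ K := by
    refine ⟨?_, hux⟩
    rw [hB, Metric.mem_closedBall]
    linarith [dist_triangle x y₀ x₀]
  have h2 := hmin x hxK
  rw [dist_comm] at h2
  have h3 : dist x y₀ = R₀ := le_antisymm h1 h2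
  have h4 : dist x y = R₀ / 2 := by linarith [dist_triangle x y y₀]
  have h5 : y = midpoint ℝ y₀ x := by
    apply eq_midpoint_of_dist_eq_half
    · rw [dist_comm, hyy₀, dist_comm y₀ x, h3]
    · rw [dist_comm, h4, dist_comm y₀ x, h3]
  rw [hy] at h5
  exact ((AffineEquiv.pointReflection_midpoint_left (R := ℝ) y₀ z).symm.trans (by
    rw [h5, AffineEquiv.pointReflection_midpoint_left])).symm

end Hopf

/-! ### Local parametrizations -/

/-- The closed half plane. -/
abbrev halfPlane : Set E2 := Set.range (𝓡∂ 2)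

lemma mem_halfPlane {x : E2} : x ∈ halfPlane ↔ 0 ≤ x 0 := by
  rw [halfPlane, range_modelWithCornersEuclideanHalfSpace]; rfl

lemma uniqueDiffOn_halfPlane : UniqueDiffOn ℝ halfPlane := (𝓡∂ 2).uniqueDiffOn

section Param

variable {X : E2 → E3} {x : E2}

lemma contDiffWithinAt_pderiv (h : ContDiffWithinAt ℝ ∞ X halfPlane x) (hx : x ∈ halfPlane)
    (i : Fin 2) : ContDiffWithinAt ℝ ∞ (pderiv halfPlane X i) halfPlane x :=
  (h.fderivWithin_right uniqueDiffOn_halfPlane (by simp) hx).clm_apply contDiffWithinAt_const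

lemma pderiv_eq_of_hasFDerivWithinAt {S : Set E2} (hS : UniqueDiffWithinAt ℝ S x) {L : E2 →L[ℝ] E3}
    (h : HasFDerivWithinAt X L S x) (i : Fin 2) :
    StationarySurface.pderiv S X i x = L (EuclideanSpace.single i 1) := by
  rw [StationarySurface.pderiv, h.fderivWithin hS]

lemma clm_apply_eq {F : Type*} [NormedAddCommGroup F] [NormedSpace ℝ F] (L : E2 →L[ℝ] F) (ξ : E2) :
    L ξ = ξ 0 • L (EuclideanSpace.single 0 1) + ξ 1 • L (EuclideanSpace.single 1 1) := by
  rw [← map_smul, ← map_smul, ← map_add]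
  congr 1
  ext i
  fin_cases i <;> simp

lemma fderivWithin_apply_eq {S : Set E2} (ξ : E2) :
    fderivWithin ℝ X S x ξ = ξ 0 • pderiv S X 0 x + ξ 1 • pderiv S X 1 x :=
  clm_apply_eq _ ξ

/-- The vector `|A|² B - ⟨A, B⟩ A` is nonzero, and its squared length is `|A|²` times the Gram
determinant. -/
lemma gram_det_pos {A B : E3} (h : LinearIndependent ℝ ![A, B]) :
    0 < inner ℝ A A * inner ℝ B B - inner ℝ A B ^ 2 := by
  rw [LinearIndependent.pair_iff] at h
  have hA : A ≠ 0 := by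
    rintro rfl
    simpa using h 1 0 (by simp)
  have hA' : 0 < inner ℝ A A := real_inner_self_pos.2 hA
  have hne : inner ℝ A A • B - inner ℝ A B • A ≠ 0 := by
    intro h0
    have := (h (-inner ℝ A B) (inner ℝ A A) (by rw [← h0, neg_smul]; abel)).2
    exact hA'.ne' this
  have h1 := real_inner_self_pos.2 hne
  have h2 : inner ℝ (inner ℝ A A • B - inner ℝ A B • A) (inner ℝ A A • B - inner ℝ A B • A)
      = inner ℝ A A * (inner ℝ A A * inner ℝ B B - inner ℝ A B ^ 2) := by
    simp only [inner_sub_left, inner_sub_right, inner_smul_left, inner_smul_right, conj_trivial,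
      real_inner_comm A B]
    ring
  rw [h2] at h1
  exact pos_of_mul_pos_right h1 hA'.le

lemma linearIndependent_pderiv {S : Set E2}
    (h : Function.Injective (fderivWithin ℝ X S x)) :
    LinearIndependent ℝ ![pderiv S X 0 x, pderiv S X 1 x] := by
  rw [LinearIndependent.pair_iff]
  intro s t hst
  have : fderivWithin ℝ X S x !₂[s, t] = fderivWithin ℝ X S x 0 := by
    rw [fderivWithin_apply_eq, map_zero]; simpa using hst
  have := h this
  exact ⟨by simpa using congrArg (fun z : E2 => z 0) this,
    by simpa using congrArg (fun z : E2 => z 1) this⟩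

lemma firstForm_det_pos {S : Set E2} (h : Function.Injective (fderivWithin ℝ X S x)) :
    0 < firstForm S X 0 0 x * firstForm S X 1 1 x - firstForm S X 0 1 x ^ 2 :=
  gram_det_pos (linearIndependent_pderiv h)

lemma firstForm_pos {S : Set E2} (h : Function.Injective (fderivWithin ℝ X S x)) (i : Fin 2) :
    0 < firstForm S X i i x := by
  refine real_inner_self_pos.2 fun h0 => ?_
  have := h (h0.trans (map_zero _).symm : fderivWithin ℝ X S x (EuclideanSpace.single i 1) = _)
  simpa using congrArg (fun z : E2 => z i) this

end Param

section Chart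

variable {E H F : Type*} [NormedAddCommGroup E] [NormedSpace ℝ E] [TopologicalSpace H]
  [NormedAddCommGroup F] [NormedSpace ℝ F] {I : ModelWithCorners ℝ E H}
  {M : Type*} [TopologicalSpace M] {f : M → F} {e : OpenPartialHomeomorph M H} {x : E}

lemma extend_target_mem_nhdsWithin' (hx : x ∈ (e.extend I).target) :
    (e.extend I).target ∈ 𝓝[range I] x := by
  have hs := (e.extend I).map_target hx
  have := e.extend_target_mem_nhdsWithin (I := I) (e.extend_source (I := I) ▸ hs)
  rwa [(e.extend I).right_inv hx] at this

variable [ChartedSpace H M]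

lemma contDiffWithinAt_comp_extend_symm (hf : ContMDiff I 𝓘(ℝ, F) ∞ f)
    (he : e ∈ IsManifold.maximalAtlas I ∞ M) (hx : x ∈ (e.extend I).target) :
    ContDiffWithinAt ℝ ∞ (f ∘ (e.extend I).symm) (range I) x := by
  have h1 := contMDiffOn_extend_symm he
  have h2 : ContMDiffOn 𝓘(ℝ, E) 𝓘(ℝ, F) ∞ (f ∘ (e.extend I).symm) (I '' e.target) :=
    hf.comp_contMDiffOn h1
  rw [← e.extend_target'] at h2
  exact (contMDiffOn_iff_contDiffOn.1 h2 x hx).mono_of_mem_nhdsWithin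
    (extend_target_mem_nhdsWithin' hx)

/-- By the chain rule, the derivative of the inverse chart has the derivative of the chart as left
inverse, so it is injective; compose with that of `f`. -/
lemma injective_fderivWithin_comp_extend_symm (hf : ContMDiff I 𝓘(ℝ, F) ∞ f)
    (hi : ∀ p : M, Function.Injective (mfderiv I 𝓘(ℝ, F) f p))
    (he : e ∈ IsManifold.maximalAtlas I ∞ M) (hx : x ∈ (e.extend I).target) :
    Function.Injective (fderivWithin ℝ (f ∘ (e.extend I).symm) (range I) x) := by
  set g := (e.extend I).symm with hg
  have hxS : x ∈ range I := e.extend_target_subset_range hx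
  have hu : UniqueMDiffWithinAt 𝓘(ℝ, E) (range I) x :=
    (I.uniqueDiffOn x hxS).uniqueMDiffWithinAt
  have hgd : MDifferentiableWithinAt 𝓘(ℝ, E) I g (range I) x := by
    have := contMDiffOn_extend_symm he
    rw [← e.extend_target'] at this
    exact ((this x hx).mdifferentiableWithinAt (by simp)).mono_of_mem_nhdsWithin
      (extend_target_mem_nhdsWithin' hx)
  have hpe : g x ∈ e.source := e.extend_source (I := I) ▸ (e.extend I).map_target hx
  have hed : MDifferentiableAt I 𝓘(ℝ, E) (e.extend I) (g x) :=
    (e.contMDiffAt_extend he hpe).mdifferentiableAt (by simp)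
  have hfd : MDifferentiableAt I 𝓘(ℝ, F) f (g x) := (hf (g x)).mdifferentiableAt (by simp)
  have h1 : mfderivWithin 𝓘(ℝ, E) 𝓘(ℝ, F) (f ∘ g) (range I) x =
      (mfderiv I 𝓘(ℝ, F) f (g x)).comp (mfderivWithin 𝓘(ℝ, E) I g (range I) x) :=
    mfderiv_comp_mfderivWithin x hfd hgd hu
  have h2 : mfderivWithin 𝓘(ℝ, E) 𝓘(ℝ, E) (e.extend I ∘ g) (range I) x =
      (mfderiv I 𝓘(ℝ, E) (e.extend I) (g x)).comp (mfderivWithin 𝓘(ℝ, E) I g (range I) x) :=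
    mfderiv_comp_mfderivWithin x hed hgd hu
  have h3 : mfderivWithin 𝓘(ℝ, E) 𝓘(ℝ, E) (e.extend I ∘ g) (range I) x
      = ContinuousLinearMap.id ℝ E := by
    rw [mfderivWithin_eq_fderivWithin]
    have : (e.extend I ∘ g) =ᶠ[𝓝[range I] x] id := by
      filter_upwards [extend_target_mem_nhdsWithin' hx] with y hy using (e.extend I).right_inv hy
    rw [this.fderivWithin_eq ((e.extend I).right_inv hx), fderivWithin_id (I.uniqueDiffOn x hxS)]
  have h4 : Function.Injective (mfderivWithin 𝓘(ℝ, E) I g (range I) x) := by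
    have h5 : ∀ v, mfderiv I 𝓘(ℝ, E) (e.extend I) (g x)
        (mfderivWithin 𝓘(ℝ, E) I g (range I) x v) = v :=
      fun v => congrArg (fun L => L v) (h2.symm.trans h3)
    exact Function.LeftInverse.injective h5
  rw [← mfderivWithin_eq_fderivWithin, h1]
  exact (hi (g x)).comp h4

end Chart

section LocalParam

variable {M : Type*} [TopologicalSpace M] [ChartedSpace (EuclideanHalfSpace 2) M] {f : M → E3}
  {e : OpenPartialHomeomorph M (EuclideanHalfSpace 2)} {x : E2} {α : ℝ}

lemma IsCompactStationary.contDiffWithinAt_localParam (h : IsCompactStationary α f)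
    (he : e ∈ IsManifold.maximalAtlas (𝓡∂ 2) ∞ M) (hx : x ∈ (e.extend (𝓡∂ 2)).target) :
    ContDiffWithinAt ℝ ∞ (localParam f e) halfPlane x :=
  contDiffWithinAt_comp_extend_symm h.smooth he hx

lemma IsCompactStationary.injective_fderivWithin_localParam (h : IsCompactStationary α f)
    (he : e ∈ IsManifold.maximalAtlas (𝓡∂ 2) ∞ M) (hx : x ∈ (e.extend (𝓡∂ 2)).target) :
    Function.Injective (fderivWithin ℝ (localParam f e) halfPlane x) :=
  injective_fderivWithin_comp_extend_symm h.smooth h.immersion he hx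

end LocalParam

/-! ### The elliptic equation for the squared distance to the origin -/

lemma hasGradAt_inner {A B : E2 → E3} {x : E2} (hS : halfPlane ∈ 𝓝 x)
    (hA : ContDiffWithinAt ℝ ∞ A halfPlane x) (hB : ContDiffWithinAt ℝ ∞ B halfPlane x) :
    HasGradAt (fun y => inner ℝ (A y) (B y))
      (inner ℝ (A x) (pderiv halfPlane B 0 x) + inner ℝ (pderiv halfPlane A 0 x) (B x))
      (inner ℝ (A x) (pderiv halfPlane B 1 x) + inner ℝ (pderiv halfPlane A 1 x) (B x)) x := by
  have hA' := (hA.differentiableWithinAt (by simp)).hasFDerivWithinAt.hasFDerivAt hS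
  have hB' := (hB.differentiableWithinAt (by simp)).hasFDerivWithinAt.hasFDerivAt hS
  refine (hA'.inner ℝ hB').congr_fderiv ?_
  ext ξ
  simp only [ContinuousLinearMap.comp_apply, ContinuousLinearMap.prod_apply, fderivInnerCLM_apply,
    fderivWithin_apply_eq, inner_add_left, inner_add_right, inner_smul_left, inner_smul_right,
    conj_trivial, add_apply, smul_apply, PiLp.proj_apply, smul_eq_mul]
  ring

lemma pderiv_comm {X : E2 → E3} {x : E2} (hx : x ∈ halfPlane) (hS : halfPlane ∈ 𝓝 x)
    (h : ContDiffWithinAt ℝ ∞ X halfPlane x) (i j : Fin 2) :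
    pderiv halfPlane (pderiv halfPlane X i) j x = pderiv halfPlane (pderiv halfPlane X j) i x := by
  have hsymm : IsSymmSndFDerivWithinAt ℝ X halfPlane x :=
    h.isSymmSndFDerivWithinAt (by simp [minSmoothness_of_isRCLikeNormedField]; norm_cast)
      uniqueDiffOn_halfPlane (subset_closure (mem_interior_iff_mem_nhds.2 hS)) hx
  have key : ∀ i j : Fin 2, pderiv halfPlane (pderiv halfPlane X i) j x =
      fderivWithin ℝ (fderivWithin ℝ X halfPlane) halfPlane x (EuclideanSpace.single j 1)
        (EuclideanSpace.single i 1) := by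
    intro i j
    have hd : DifferentiableWithinAt ℝ (fderivWithin ℝ X halfPlane) halfPlane x :=
      (h.fderivWithin_right (m := ∞) uniqueDiffOn_halfPlane (by simp) hx).differentiableWithinAt
        (by simp)
    have := hd.hasFDerivWithinAt.clm_apply
      (hasFDerivWithinAt_const (EuclideanSpace.single i (1 : ℝ)) x halfPlane)
    refine (pderiv_eq_of_hasFDerivWithinAt (uniqueDiffOn_halfPlane x hx) this j).trans ?_
    simp
  rw [key, key]
  exact hsymm _ _

/-- The trace identity behind the maximum principle, at one point: if `Y`, `A`, `B` are the values
of a parametrization and its first derivatives and `AA`, `AB`, `BB` those of its second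
derivatives, and if the mean curvature satisfies the equation of `-2`-stationary surfaces, then
`|X|²` satisfies an elliptic equation without zero order term. -/
lemma trace_identity {Y A B AA AB BB : E3} (hY : Y ≠ 0)
    (hdet : 0 < inner ℝ A A * inner ℝ B B - inner ℝ A B ^ 2)
    (h : ∀ ν : E3, ‖ν‖ = 1 → inner ℝ ν A = 0 → inner ℝ ν B = 0 →
      (inner ℝ AA ν * inner ℝ B B - 2 * inner ℝ AB ν * inner ℝ A B + inner ℝ BB ν * inner ℝ A A) /
        (inner ℝ A A * inner ℝ B B - inner ℝ A B ^ 2) = (-2) * (inner ℝ ν Y / ‖Y‖ ^ 2))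
    {S : E3} (hS : S = inner ℝ B B • AA - (2 * inner ℝ A B) • AB + inner ℝ A A • BB) :
    2 * inner ℝ S Y + 4 * (inner ℝ A A * inner ℝ B B - inner ℝ A B ^ 2) =
      4 * (inner ℝ B B * inner ℝ Y A ^ 2 - 2 * inner ℝ A B * inner ℝ Y A * inner ℝ Y B
        + inner ℝ A A * inner ℝ Y B ^ 2) / ‖Y‖ ^ 2 +
      2 * (inner ℝ Y A * (inner ℝ B B * inner ℝ S A - inner ℝ A B * inner ℝ S B) +
        inner ℝ Y B * (inner ℝ A A * inner ℝ S B - inner ℝ A B * inner ℝ S A)) /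
        (inner ℝ A A * inner ℝ B B - inner ℝ A B ^ 2) := by
  set a := inner ℝ A A with ha
  set b := inner ℝ A B with hb
  set c := inner ℝ B B with hc
  set y := inner ℝ Y A with hy
  set z := inner ℝ Y B with hz
  set D := a * c - b ^ 2 with hD
  have hYpos : 0 < ‖Y‖ ^ 2 := by positivity
  -- `D` times the normal part of `Y`: the tangential part is removed by Cramer's rule, without
  -- dividing. Its normalization is the `ν` to which the curvature equation is applied; if `N = 0`
  -- both sides of `key` vanish.
  set N : E3 := D • Y - (c * y - b * z) • A - (a * z - b * y) • B with hN
  have hNA : inner ℝ N A = 0 := by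
    simp only [hN, inner_sub_left, inner_smul_left, conj_trivial, ← ha, ← hy, real_inner_comm A B,
      ← hb, hD]
    ring
  have hNB : inner ℝ N B = 0 := by
    simp only [hN, inner_sub_left, inner_smul_left, conj_trivial, ← hc, ← hz, ← hb, hD]
    ring
  have hNY : inner ℝ N Y = D * ‖Y‖ ^ 2 - (c * y ^ 2 - 2 * b * y * z + a * z ^ 2) := by
    simp only [hN, inner_sub_left, inner_smul_left, conj_trivial, real_inner_comm Y A,
      real_inner_comm Y B, ← hy, ← hz, real_inner_self_eq_norm_sq]
    ring
  have hSN : inner ℝ S N = D * inner ℝ S Y - (c * y - b * z) * inner ℝ S A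
      - (a * z - b * y) * inner ℝ S B := by
    simp only [hN, inner_sub_right, inner_smul_right]
  have key : inner ℝ S N * ‖Y‖ ^ 2 = -2 * D * inner ℝ N Y := by
    by_cases hN0 : N = 0
    · simp [hN0]
    · have hNpos : 0 < ‖N‖ := norm_pos_iff.2 hN0
      have h1 := h (‖N‖⁻¹ • N) (by rw [norm_smul, norm_inv, norm_norm, inv_mul_cancel₀ hNpos.ne'])
        (by rw [inner_smul_left, hNA]; simp) (by rw [inner_smul_left, hNB]; simp)
      simp only [inner_smul_left, inner_smul_right, conj_trivial] at h1
      have h2 : inner ℝ S N = inner ℝ AA N * c - 2 * inner ℝ AB N * b + inner ℝ BB N * a := by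
        simp only [hS, inner_add_left, inner_sub_left, inner_smul_left, conj_trivial]
        ring
      field_simp at h1
      rw [h2]
      linarith
  rw [hNY, hSN] at key
  field_simp
  linarith

section MaxPrinciple

variable {M : Type*} [TopologicalSpace M] [ChartedSpace (EuclideanHalfSpace 2) M] {f : M → E3}

lemma HasGradAt.congr {u v : E2 → ℝ} {p q p' q' : ℝ} {x : E2} (h : HasGradAt u p q x)
    (hu : v = u) (hp : p' = p) (hq : q' = q) : HasGradAt v p' q' x := by
  rw [hu, hp, hq]; exact h

lemma HasGradAt.const_mul {u : E2 → ℝ} {p q : ℝ} {x : E2} (h : HasGradAt u p q x) (σ : ℝ) :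
    HasGradAt (fun y => σ * u y) (σ * p) (σ * q) x := by
  unfold HasGradAt at *
  refine (HasFDerivAt.const_mul h σ).congr_fderiv ?_
  ext ξ
  simp; ring

/-- The strong maximum principle (and, with `σ = -1`, the strong minimum principle) for the
distance to the origin along a `-2`-stationary surface. -/
theorem IsCompactStationary.eventually_norm_sq_eq (h : IsCompactStationary (-2) f) (σ : ℝ) {m : ℝ}
    (hm : ∀ q, σ * ‖f q‖ ^ 2 ≤ m) {p : M} (hp : (𝓡∂ 2).IsInteriorPoint p)
    (hpm : σ * ‖f p‖ ^ 2 = m) : ∀ᶠ q in 𝓝 p, σ * ‖f q‖ ^ 2 = m := by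
  have hM := h.isManifold
  set e := chartAt (EuclideanHalfSpace 2) p with he
  have hmem : e ∈ IsManifold.maximalAtlas (𝓡∂ 2) ∞ M := IsManifold.chart_mem_maximalAtlas p
  set X : E2 → E3 := localParam f e with hX
  set Ω : Set E2 := interior (e.extend (𝓡∂ 2)).target with hΩ
  have hΩt : ∀ {x}, x ∈ Ω → x ∈ (e.extend (𝓡∂ 2)).target := fun hx => interior_subset hx
  have hΩS : ∀ {x}, x ∈ Ω → halfPlane ∈ 𝓝 x := fun {x} hx =>
    mem_of_superset (mem_interior_iff_mem_nhds.1 hx) e.extend_target_subset_range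
  have hΩH : ∀ {x}, x ∈ Ω → x ∈ halfPlane := fun hx => mem_of_mem_nhds (hΩS hx)
  have dX : ∀ {x}, x ∈ Ω → ContDiffWithinAt ℝ ∞ X halfPlane x := fun hx =>
    h.contDiffWithinAt_localParam hmem (hΩt hx)
  have dX1 : ∀ i {x}, x ∈ Ω → ContDiffWithinAt ℝ ∞ (pderiv halfPlane X i) halfPlane x :=
    fun i x hx => contDiffWithinAt_pderiv (dX hx) (hΩH hx) i
  have dX2 : ∀ i j {x}, x ∈ Ω →
      ContDiffWithinAt ℝ ∞ (pderiv halfPlane (pderiv halfPlane X i) j) halfPlane x :=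
    fun i j x hx => contDiffWithinAt_pderiv (dX1 i hx) (hΩH hx) j
  have hinj : ∀ {x}, x ∈ Ω → Function.Injective (fderivWithin ℝ X halfPlane x) := fun hx =>
    h.injective_fderivWithin_localParam hmem (hΩt hx)
  have cont : ∀ {Z : E2 → E3}, (∀ {x}, x ∈ Ω → ContDiffWithinAt ℝ ∞ Z halfPlane x) →
      ContinuousOn Z Ω := fun hZ x hx =>
    (hZ hx).continuousWithinAt.mono fun y hy => hΩH hy
  set A := pderiv halfPlane X 0 with hA
  set B := pderiv halfPlane X 1 with hB
  set AA := pderiv halfPlane A 0 with hAA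
  set AB := pderiv halfPlane A 1 with hAB
  set BA := pderiv halfPlane B 0 with hBA
  set BB := pderiv halfPlane B 1 with hBB
  have cX := cont dX
  have cA : ContinuousOn A Ω := cont (dX1 0)
  have cB : ContinuousOn B Ω := cont (dX1 1)
  have cAA : ContinuousOn AA Ω := cont (dX2 0 0)
  have cAB : ContinuousOn AB Ω := cont (dX2 0 1)
  have cBB : ContinuousOn BB Ω := cont (dX2 1 1)
  set a : E2 → ℝ := fun x => inner ℝ (A x) (A x) with ha
  set b : E2 → ℝ := fun x => inner ℝ (A x) (B x) with hb
  set c : E2 → ℝ := fun x => inner ℝ (B x) (B x) with hc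
  set y : E2 → ℝ := fun x => inner ℝ (X x) (A x) with hy
  set z : E2 → ℝ := fun x => inner ℝ (X x) (B x) with hz
  set S : E2 → E3 := fun x => c x • AA x - (2 * b x) • AB x + a x • BB x with hS
  set sA : E2 → ℝ := fun x => inner ℝ (S x) (A x) with hsA
  set sB : E2 → ℝ := fun x => inner ℝ (S x) (B x) with hsB
  set D : E2 → ℝ := fun x => a x * c x - b x ^ 2 with hD
  have hDpos : ∀ {x}, x ∈ Ω → 0 < D x := fun hx => firstForm_det_pos (hinj hx)
  have hX0 : ∀ x, X x ≠ 0 := fun x => h.ne_zero _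
  have ca : ContinuousOn a Ω := cA.inner cA
  have cb : ContinuousOn b Ω := cA.inner cB
  have cc : ContinuousOn c Ω := cB.inner cB
  have cy : ContinuousOn y Ω := cX.inner cA
  have cz : ContinuousOn z Ω := cX.inner cB
  have cS : ContinuousOn S Ω := ((cc.smul cAA).sub ((continuousOn_const.mul cb).smul cAB)).add
    (ca.smul cBB)
  have csA : ContinuousOn sA Ω := cS.inner cA
  have csB : ContinuousOn sB Ω := cS.inner cB
  have cD : ContinuousOn D Ω := (ca.mul cc).sub (cb.pow 2)
  have cn : ContinuousOn (fun x => ‖X x‖ ^ 2) Ω := cX.norm.pow 2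
  have hn : ∀ x, ‖X x‖ ^ 2 ≠ 0 := fun x => by simpa using hX0 x
  -- The term quadratic in the gradient is made linear by freezing one factor inside the
  -- coefficients. The second summand is the Christoffel part of the Laplacian.
  set β : E2 → ℝ := fun x =>
    -(2 * (c x * y x - b x * z x) / ‖X x‖ ^ 2 + (c x * sA x - b x * sB x) / D x) with hβ
  set γ : E2 → ℝ := fun x =>
    -(2 * (a x * z x - b x * y x) / ‖X x‖ ^ 2 + (a x * sB x - b x * sA x) / D x) with hγ
  -- The principal part is the cofactor matrix of the first fundamental form, that is `D g^{ij}`.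
  have hE : EllipticOn Ω c (fun x => -b x) a β γ :=
    { isOpen := isOpen_interior
      cont_a := cc
      cont_b := cb.neg
      cont_c := ca
      cont_β := (((continuousOn_const.mul ((cc.mul cy).sub (cb.mul cz))).div cn fun x _ => hn x).add
        (((cc.mul csA).sub (cb.mul csB)).div cD fun x hx => (hDpos hx).ne')).neg
      cont_γ := (((continuousOn_const.mul ((ca.mul cz).sub (cb.mul cy))).div cn fun x _ => hn x).add
        (((ca.mul csB).sub (cb.mul csA)).div cD fun x hx => (hDpos hx).ne')).neg
      pos := fun x hx => firstForm_pos (hinj hx) 1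
      det_pos := fun x hx => by have := hDpos hx; simp only [hD] at this; linarith }
  have hSub : SubsolutionOn Ω c (fun x => -b x) a β γ (fun x => σ * inner ℝ (X x) (X x))
      (fun x => (2 * σ) * inner ℝ (X x) (A x)) (fun x => (2 * σ) * inner ℝ (X x) (B x))
      (fun x => (2 * σ) * (inner ℝ (X x) (AA x) + inner ℝ (A x) (A x)))
      (fun x => (2 * σ) * (inner ℝ (X x) (AB x) + inner ℝ (B x) (A x)))
      (fun x => (2 * σ) * (inner ℝ (X x) (BA x) + inner ℝ (A x) (B x)))
      (fun x => (2 * σ) * (inner ℝ (X x) (BB x) + inner ℝ (B x) (B x))) := by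
    refine ⟨fun x hx => ?_, fun x hx => ?_, fun x hx => ?_, fun x hx => ?_⟩
    · refine ((hasGradAt_inner (hΩS hx) (dX hx) (dX hx)).const_mul σ).congr rfl ?_ ?_
      · rw [real_inner_comm (X x)]; ring
      · rw [real_inner_comm (X x)]; ring
    · exact (hasGradAt_inner (hΩS hx) (dX hx) (dX1 0 hx)).const_mul (2 * σ)
    · exact (hasGradAt_inner (hΩS hx) (dX hx) (dX1 1 hx)).const_mul (2 * σ)
    · have hBA' : BA x = AB x := pderiv_comm (hΩH hx) (hΩS hx) (dX hx) 1 0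
      have htr := trace_identity (AA := AA x) (AB := AB x) (BB := BB x) (S := S x)
        (hX0 x) (hDpos hx) (fun ν hν h1 h2 => h.stationary e hmem x (hΩt hx) ν hν
          (fun i => by fin_cases i <;> assumption)) rfl
      have hSX : inner ℝ (S x) (X x) = c x * inner ℝ (X x) (AA x)
          - 2 * b x * inner ℝ (X x) (AB x) + a x * inner ℝ (X x) (BB x) := by
        rw [real_inner_comm]
        simp only [hS, inner_add_right, inner_sub_right, inner_smul_right]
      rw [hSX] at htr
      rw [hBA']
      -- The inequality is an equality, `σ` times the trace identity; this is why both signs of `σ`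
      -- are allowed.
      refine le_of_eq ?_
      have hDx := (hDpos hx).ne'
      have hnx := hn x
      rw [real_inner_comm (A x) (B x)]
      simp only [hβ, hγ]
      change 0 = c x * (2 * σ * (inner ℝ (X x) (AA x) + a x)) +
        -b x * (2 * σ * (inner ℝ (X x) (AB x) + b x) + 2 * σ * (inner ℝ (X x) (AB x) + b x)) +
        a x * (2 * σ * (inner ℝ (X x) (BB x) + c x)) + _ * (2 * σ * y x) + _ * (2 * σ * z x)
      change _ = 4 * (c x * y x ^ 2 - 2 * b x * y x * z x + a x * z x ^ 2) / ‖X x‖ ^ 2 +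
        2 * (y x * (c x * sA x - b x * sB x) + z x * (a x * sB x - b x * sA x)) / D x at htr
      change 2 * _ + 4 * D x = _ at htr
      have hDdef : D x = a x * c x - b x ^ 2 := rfl
      calc (0 : ℝ) = σ * ((2 * (c x * inner ℝ (X x) (AA x) - 2 * b x * inner ℝ (X x) (AB x)
            + a x * inner ℝ (X x) (BB x)) + 4 * D x) -
            (4 * (c x * y x ^ 2 - 2 * b x * y x * z x + a x * z x ^ 2) / ‖X x‖ ^ 2 +
        2 * (y x * (c x * sA x - b x * sB x) + z x * (a x * sB x - b x * sA x)) / D x)) := by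
              rw [htr]; ring
        _ = _ := by
          nth_rewrite 1 [hDdef]
          ring
  have hpe : p ∈ e.source := mem_chart_source _ p
  have hx₀ : e.extend (𝓡∂ 2) p ∈ Ω := by
    rw [hΩ]
    exact ((𝓡∂ 2).isInteriorPoint_iff).1 hp
  have hXe : ∀ q ∈ e.source, X (e.extend (𝓡∂ 2) q) = f q := fun q hq => by
    simp only [hX, localParam, Function.comp_apply]
    rw [e.extend_left_inv hq]
  have hmax := hSub.eventually_eq_of_max hE (m := m)
    (fun x _ => by rw [real_inner_self_eq_norm_sq]; exact hm _) hx₀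
    (by rw [real_inner_self_eq_norm_sq, hXe p hpe]; exact hpm)
  have hc := (e.continuousAt_extend (I := 𝓡∂ 2) hpe).eventually hmax
  filter_upwards [hc, e.open_source.mem_nhds hpe] with q hq hqe
  rwa [real_inner_self_eq_norm_sq, hXe q hqe] at hq

/-- If the maximum exceeded the boundary value, the set where it is attained would contain only
interior points, hence be clopen by the strong maximum principle, and by connectedness would reach
the boundary. -/
lemma IsCompactStationary.mul_norm_sq_le (h : IsCompactStationary (-2) f) (σ : ℝ) {k : ℝ}
    (hne : ((𝓡∂ 2).boundary M).Nonempty)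
    (hb : ∀ p ∈ (𝓡∂ 2).boundary M, σ * ‖f p‖ ^ 2 = k) (q : M) : σ * ‖f q‖ ^ 2 ≤ k := by
  have hM := h.isManifold
  have hC := h.compactSpace
  have hconn := h.connectedSpace
  have hcont : Continuous f := ContMDiff.continuous h.smooth
  have hcw : Continuous fun q => σ * ‖f q‖ ^ 2 := by fun_prop
  obtain ⟨p, -, hp⟩ := isCompact_univ.exists_isMaxOn (univ_nonempty (α := M)) hcw.continuousOn
  have hp' : ∀ q, σ * ‖f q‖ ^ 2 ≤ σ * ‖f p‖ ^ 2 := fun q => hp (mem_univ q)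
  refine (hp' q).trans ?_
  by_contra! hlt
  have hcl : IsClopen {q | σ * ‖f q‖ ^ 2 = σ * ‖f p‖ ^ 2} := by
    refine ⟨isClosed_eq hcw continuous_const, isOpen_iff_mem_nhds.2 fun r hr => ?_⟩
    refine h.eventually_norm_sq_eq σ hp' ?_ hr
    rw [(𝓡∂ 2).isInteriorPoint_iff_not_isBoundaryPoint]
    intro hbd
    have := hb r hbd
    exact absurd (this.symm.trans hr) hlt.ne
  have huniv := hcl.eq_univ ⟨p, rfl⟩
  obtain ⟨r, hr⟩ := hne
  have h1 : σ * ‖f r‖ ^ 2 = σ * ‖f p‖ ^ 2 := (eq_univ_iff_forall.1 huniv) r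
  have := hb r hr
  linarith

/-- A compact `-2`-stationary surface whose boundary lies on a sphere centred at the origin lies
on this sphere. -/
theorem IsCompactStationary.norm_eq (h : IsCompactStationary (-2) f) {r : ℝ} (hr : 0 < r)
    (hne : ((𝓡∂ 2).boundary M).Nonempty) (hb : ∀ p ∈ (𝓡∂ 2).boundary M, ‖f p‖ = r) (q : M) :
    ‖f q‖ = r := by
  have h1 := h.mul_norm_sq_le 1 hne (k := r ^ 2) (fun p hp => by rw [hb p hp, one_mul]) q
  have h2 := h.mul_norm_sq_le (-1) hne (k := -r ^ 2) (fun p hp => by rw [hb p hp]; ring) q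
  have h3 : ‖f q‖ ^ 2 = r ^ 2 := by linarith
  exact (sq_eq_sq₀ (norm_nonneg _) hr.le).1 h3

end MaxPrinciple

/-! ### Extension across the edge of the half plane -/

/-- The nearest point projection of the plane onto the closed half plane. -/
noncomputable def toHalfPlane (x : E2) : E2 := !₂[max (x 0) 0, x 1]

lemma toHalfPlane_mem (x : E2) : toHalfPlane x ∈ halfPlane :=
  mem_halfPlane.2 (by simp [toHalfPlane])

lemma toHalfPlane_of_mem {x : E2} (hx : x ∈ halfPlane) : toHalfPlane x = x := by
  ext i
  fin_cases i
  · simpa [toHalfPlane] using mem_halfPlane.1 hx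
  · simp [toHalfPlane]

lemma dist_toHalfPlane_le (x y : E2) : dist (toHalfPlane x) (toHalfPlane y) ≤ dist x y := by
  rw [← sq_le_sq₀ dist_nonneg dist_nonneg, dist_sq_eq, dist_sq_eq]
  have h : |max (x 0) 0 - max (y 0) 0| ≤ |x 0 - y 0| := abs_max_sub_max_le_abs _ _ _
  have := sq_le_sq.2 h
  simpa [toHalfPlane] using this

/-- The extension of a map on the closed half plane which is linear in the normal direction
outside, with given derivative `A`. -/
noncomputable def edgeExtension (X : E2 → E3) (A : E2 →L[ℝ] E3) (x : E2) : E3 :=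
  X (toHalfPlane x) + A (x - toHalfPlane x)

lemma edgeExtension_of_mem (X : E2 → E3) (A : E2 →L[ℝ] E3) {x : E2} (hx : x ∈ halfPlane) :
    edgeExtension X A x = X x := by
  simp [edgeExtension, toHalfPlane_of_mem hx]

/-- The linear terms cancel in the error, leaving the error of `X` between the two projected points.
The mean value inequality on the convex half plane bounds it, and the projection does not increase
distances. This makes inverse function arguments available at boundary points. -/
lemma hasStrictFDerivAt_edgeExtension {X : E2 → E3} {x₀ : E2}
    (hX : ContDiffWithinAt ℝ ∞ X halfPlane x₀) (hx₀ : x₀ ∈ halfPlane) :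
    HasStrictFDerivAt (edgeExtension X (fderivWithin ℝ X halfPlane x₀))
      (fderivWithin ℝ X halfPlane x₀) x₀ := by
  set A := fderivWithin ℝ X halfPlane x₀ with hA
  rw [hasStrictFDerivAt_iff_isLittleO, Asymptotics.isLittleO_iff]
  intro ε hε
  have hc : ContinuousWithinAt (fderivWithin ℝ X halfPlane) halfPlane x₀ :=
    (hX.fderivWithin_right (m := 0) uniqueDiffOn_halfPlane (by simp) hx₀).continuousWithinAt
  have hd : ∀ᶠ y in 𝓝[halfPlane] x₀, DifferentiableWithinAt ℝ X halfPlane y := by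
    have h1 : ContDiffWithinAt ℝ 1 X halfPlane x₀ := hX.of_le (by exact_mod_cast le_top)
    have := h1.eventually (by simp)
    rw [insert_eq_of_mem hx₀] at this
    exact this.mono fun y hy => hy.differentiableWithinAt (by simp)
  have hn : ∀ᶠ y in 𝓝[halfPlane] x₀, ‖fderivWithin ℝ X halfPlane y - A‖ ≤ ε := by
    have := hc.eventually (Metric.ball_mem_nhds A hε)
    exact this.mono fun y hy => by rw [← dist_eq_norm]; exact (Metric.mem_ball.1 hy).le
  obtain ⟨δ, hδ, hball⟩ := Metric.mem_nhdsWithin_iff.1 (hd.and hn)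
  have hconv : Convex ℝ (Metric.ball x₀ δ ∩ halfPlane) :=
    (convex_ball x₀ δ).inter (𝓡∂ 2).convex_range
  have key : ∀ y ∈ Metric.ball x₀ δ ∩ halfPlane, ∀ z ∈ Metric.ball x₀ δ ∩ halfPlane,
      ‖X y - X z - A (y - z)‖ ≤ ε * ‖y - z‖ := fun y hy z hz =>
    hconv.norm_image_sub_le_of_norm_hasFDerivWithin_le'
      (fun w hw => ((hball hw).1.hasFDerivWithinAt).mono inter_subset_right)
      (fun w hw => (hball hw).2) hz hy
  have hpi : ∀ y ∈ Metric.ball x₀ δ, toHalfPlane y ∈ Metric.ball x₀ δ ∩ halfPlane := fun y hy => by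
    refine ⟨?_, toHalfPlane_mem y⟩
    rw [Metric.mem_ball, ← toHalfPlane_of_mem hx₀]
    exact (dist_toHalfPlane_le _ _).trans_lt hy
  have hnhds : Metric.ball x₀ δ ×ˢ Metric.ball x₀ δ ∈ 𝓝 (x₀, x₀) :=
    prod_mem_nhds (Metric.ball_mem_nhds _ hδ) (Metric.ball_mem_nhds _ hδ)
  filter_upwards [hnhds] with ⟨y, z⟩ ⟨hy, hz⟩
  have h1 : edgeExtension X A y - edgeExtension X A z - A (y - z) =
      X (toHalfPlane y) - X (toHalfPlane z) - A (toHalfPlane y - toHalfPlane z) := by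
    simp only [edgeExtension, map_sub]; abel
  rw [h1]
  refine (key _ (hpi y hy) _ (hpi z hz)).trans ?_
  rw [← dist_eq_norm, ← dist_eq_norm]
  exact mul_le_mul_of_nonneg_left (dist_toHalfPlane_le _ _) hε.le

lemma HasStrictFDerivAt.exists_injOn {E F : Type*} [NormedAddCommGroup E] [NormedSpace ℝ E]
    [NormedAddCommGroup F] [NormedSpace ℝ F] [FiniteDimensional ℝ E] {g : E → F} {A : E →L[ℝ] F}
    {x₀ : E} (hg : HasStrictFDerivAt g A x₀) (hA : Function.Injective A) :
    ∃ U ∈ 𝓝 x₀, InjOn g U := by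
  obtain ⟨K, hK, hAK⟩ := (A : E →ₗ[ℝ] F).exists_antilipschitzWith (LinearMap.ker_eq_bot.2 hA)
  rw [hasStrictFDerivAt_iff_isLittleO, Asymptotics.isLittleO_iff] at hg
  have hK' : (0 : ℝ) < K := hK
  -- An error below half of the expansion constant `1 / K` of `A` cannot compensate the
  -- displacement.
  obtain ⟨U, hU, V, hV, hUV⟩ := mem_nhds_prod_iff.1 (hg (c := (2 * K : ℝ)⁻¹) (by positivity))
  refine ⟨U ∩ V, inter_mem hU hV, fun y hy z hz hyz => ?_⟩
  have h1 := hUV (mk_mem_prod hy.1 hz.2)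
  simp only [mem_ofPred_eq, hyz, sub_self, zero_sub, norm_neg] at h1
  have h2 := hAK.le_mul_dist y z
  rw [dist_eq_norm, dist_eq_norm] at h2
  have h3 : ‖(A : E →ₗ[ℝ] F) y - (A : E →ₗ[ℝ] F) z‖ = ‖A (y - z)‖ := by simp
  rw [h3] at h2
  have h4 : K * ‖A (y - z)‖ ≤ 1 / 2 * ‖y - z‖ := by
    have := mul_le_mul_of_nonneg_left h1 hK'.le
    refine this.trans (le_of_eq ?_)
    field_simp
  have h5 : ‖y - z‖ ≤ 0 := by linarith
  exact sub_eq_zero.1 (norm_le_zero_iff.1 h5)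

/-! ### Polar coordinates around an interior point of a ball -/

/-- A ray from an interior point meets the sphere once: the quadratic equation in `ρ` has the root
`1`, and the other factor is positive for `ρ > 0`. -/
lemma eq_one_of_norm_eq {E : Type*} [NormedAddCommGroup E] [InnerProductSpace ℝ E] {c a : E}
    {r ρ : ℝ} (hc : ‖c‖ < r) (ha : ‖a‖ = r) (hρ : 0 < ρ) (h : ‖c + ρ • (a - c)‖ = r) : ρ = 1 := by
  have h1 : ‖c + ρ • (a - c)‖ ^ 2 = ‖c‖ ^ 2 + 2 * ρ * inner ℝ c (a - c) + ρ ^ 2 * ‖a - c‖ ^ 2 := by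
    rw [norm_add_sq_real, norm_smul, inner_smul_right, mul_pow, Real.norm_eq_abs, sq_abs]; ring
  have h2 : ‖a‖ ^ 2 = ‖c‖ ^ 2 + 2 * inner ℝ c (a - c) + ‖a - c‖ ^ 2 := by
    rw [← norm_add_sq_real, add_sub_cancel]
  rw [h] at h1
  rw [ha] at h2
  have h3 : (ρ - 1) * (ρ * ‖a - c‖ ^ 2 + (r ^ 2 - ‖c‖ ^ 2)) = 0 := by
    linear_combination h2 * ρ - h1
  have h4 : 0 < r ^ 2 - ‖c‖ ^ 2 := by nlinarith [norm_nonneg c]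
  rcases mul_eq_zero.1 h3 with h5 | h5
  · linarith
  · have : 0 ≤ ρ * ‖a - c‖ ^ 2 := by positivity
    linarith

/-- Pairing with `n` kills the image of `A` but not `w`, so `(ξ, τ) ↦ A ξ + τ w` is injective, and
the dimensions agree. -/
lemma polar_surjective {A : E2 →L[ℝ] E3} (hA : Function.Injective A) {w n : E3}
    (hn : ∀ ξ, inner ℝ n (A ξ) = 0) (hw : inner ℝ n w ≠ 0) (y : E3) :
    ∃ (ξ : E2) (τ : ℝ), A ξ + τ • w = y := by
  let L : E2 × ℝ →ₗ[ℝ] E3 := (A : E2 →ₗ[ℝ] E3).coprod (LinearMap.toSpanSingleton ℝ E3 w)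
  have hL : ∀ ξ τ, L (ξ, τ) = A ξ + τ • w := fun ξ τ => by simp [L]
  have hinj : Function.Injective L := by
    rw [← LinearMap.ker_eq_bot, LinearMap.ker_eq_bot']
    rintro ⟨ξ, τ⟩ h
    rw [hL] at h
    have h1 : inner ℝ n (A ξ + τ • w) = 0 := by rw [h, inner_zero_right]
    rw [inner_add_right, hn, inner_smul_right, zero_add] at h1
    have hτ : τ = 0 := (mul_eq_zero.1 h1).resolve_right hw
    rw [hτ, zero_smul, add_zero] at h
    rw [hτ, hA (h.trans (map_zero A).symm)]
    rfl
  have hsurj : Function.Surjective L :=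
    (LinearMap.injective_iff_surjective_of_finrank_eq_finrank (by simp)).1 hinj
  obtain ⟨⟨ξ, τ⟩, h⟩ := hsurj y
  exact ⟨ξ, τ, (hL ξ τ).symm.trans h⟩

/-- The extension `g` may leave the sphere, so openness is obtained in space for the cone map `(x,
ρ) ↦ c + ρ (g x - c)`, whose derivative at `(x₀, 1)` is onto by transversality. -/
lemma polar_image_mem_nhds {g : E2 → E3} {A : E2 →L[ℝ] E3} {x₀ : E2} {c n : E3}
    (hg : HasStrictFDerivAt g A x₀) (hA : Function.Injective A)
    (hn : ∀ ξ, inner ℝ n (A ξ) = 0) (hw : inner ℝ n (g x₀ - c) ≠ 0) {W : Set E2} (hW : W ∈ 𝓝 x₀) :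
    {y | ∃ x ∈ W, ∃ ρ : ℝ, 0 < ρ ∧ y = c + ρ • (g x - c)} ∈ 𝓝 (g x₀) := by
  set Y : E2 × ℝ → E3 := fun p => c + p.2 • (g p.1 - c) with hY
  have h1 : HasStrictFDerivAt (fun p : E2 × ℝ => g p.1) (A.comp (ContinuousLinearMap.fst ℝ E2 ℝ))
      (x₀, (1 : ℝ)) :=
    HasStrictFDerivAt.comp (x₀, (1 : ℝ)) hg hasStrictFDerivAt_fst
  have h2 := (hasStrictFDerivAt_snd (𝕜 := ℝ) (E := E2) (F := ℝ) (p := (x₀, 1))).smul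
    (h1.sub_const c)
  have h3 := h2.const_add c
  have hmap : map Y (𝓝 (x₀, 1)) = 𝓝 (c + (1 : ℝ) • (g x₀ - c)) := h3.map_nhds_eq_of_surj (by
    rw [LinearMap.range_eq_top]
    intro y
    obtain ⟨ξ, τ, h⟩ := polar_surjective hA hn hw y
    exact ⟨(ξ, τ), by simpa using h⟩)
  have hYx : c + (1 : ℝ) • (g x₀ - c) = g x₀ := by simp
  have hmem : W ×ˢ Ioi (0 : ℝ) ∈ 𝓝 (x₀, (1 : ℝ)) :=
    prod_mem_nhds hW (Ioi_mem_nhds one_pos)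
  have := image_mem_map (m := Y) hmem
  rw [hmap, hYx] at this
  refine mem_of_superset this ?_
  rintro _ ⟨⟨x, ρ⟩, ⟨hx, hρ⟩, rfl⟩
  exact ⟨x, hx, ρ, hρ, rfl⟩

lemma inner_fderivWithin_eq_zero {X : E2 → E3} {x₀ : E2} {r : ℝ} {T : Set E2}
    (hX : DifferentiableWithinAt ℝ X halfPlane x₀) (hx₀ : x₀ ∈ halfPlane)
    (hT : T ∈ 𝓝[halfPlane] x₀) (hr : ∀ x ∈ T, ‖X x‖ = r) (ξ : E2) :
    inner ℝ (X x₀) (fderivWithin ℝ X halfPlane x₀ ξ) = 0 := by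
  have h1 := hX.hasFDerivWithinAt.inner ℝ hX.hasFDerivWithinAt
  have h2 : HasFDerivWithinAt (fun x => inner ℝ (X x) (X x)) (0 : E2 →L[ℝ] ℝ) halfPlane x₀ := by
    refine (hasFDerivWithinAt_const (r ^ 2) x₀ halfPlane).congr_of_eventuallyEq ?_ ?_
    · filter_upwards [hT] with x hx
      rw [real_inner_self_eq_norm_sq, hr x hx]
    · rw [real_inner_self_eq_norm_sq, hr x₀ (mem_of_mem_nhdsWithin hx₀ hT)]
  have h3 := congrArg (fun L => L ξ) ((uniqueDiffOn_halfPlane x₀ hx₀).eq h1 h2)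
  simp [fderivInnerCLM_apply, real_inner_comm (X x₀)] at h3
  linarith

/-! ### Local structure of an immersed surface in a sphere -/

section LocalStructure

variable {M : Type*} [TopologicalSpace M] [ChartedSpace (EuclideanHalfSpace 2) M] {f : M → E3}

/-- A local description of `f` near `p`: coordinates `φ` with values in the closed half plane and
inverse `ψ`, and a map `g` defined on the whole plane, strictly differentiable at `φ p` with
injective derivative `A`, which describes `f` in these coordinates. -/
structure IsLocalModel (f : M → E3) (p : M) (φ : M → E2) (ψ : E2 → M) (g : E2 → E3)
    (A : E2 →L[ℝ] E3) : Prop where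
  continuousAt : ContinuousAt φ p
  near : ∀ᶠ q in 𝓝 p, φ q ∈ halfPlane ∧ ψ (φ q) = q ∧ g (φ q) = f q ∧
    (q ∈ (𝓡∂ 2).boundary M ↔ φ q 0 = 0)
  tendsto : Tendsto ψ (𝓝[halfPlane] (φ p)) (𝓝 p)
  near_symm : ∀ᶠ x in 𝓝[halfPlane] (φ p), f (ψ x) = g x ∧ (x 0 = 0 → ψ x ∈ (𝓡∂ 2).boundary M)
  strict : HasStrictFDerivAt g A (φ p)
  injective : Function.Injective A
  normal : ∀ ξ, inner ℝ (f p) (A ξ) = 0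

lemma mem_interior_target_iff {M : Type*} [TopologicalSpace M]
    {e : OpenPartialHomeomorph M (EuclideanHalfSpace 2)} {x : E2}
    (hx : x ∈ (e.extend (𝓡∂ 2)).target) : x ∈ interior (e.extend (𝓡∂ 2)).target ↔ x 0 ≠ 0 := by
  have hx' : 0 ≤ x 0 := mem_halfPlane.1 (e.extend_target_subset_range hx)
  constructor
  · intro h
    have h1 : x ∈ interior (range (𝓡∂ 2)) := interior_mono e.extend_target_subset_range h
    rw [interior_range_modelWithCornersEuclideanHalfSpace] at h1
    exact (show 0 < x 0 from h1).ne'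
  · intro h
    have h1 : x ∈ interior (range (𝓡∂ 2)) := by
      rw [interior_range_modelWithCornersEuclideanHalfSpace]
      exact lt_of_le_of_ne hx' h.symm
    have h2 : (e.extend (𝓡∂ 2)).target ∈ 𝓝[halfPlane] x := extend_target_mem_nhdsWithin' hx
    rw [nhdsWithin_eq_nhds.2 (mem_interior_iff_mem_nhds.1 h1)] at h2
    exact mem_interior_iff_mem_nhds.2 h2

lemma mem_boundary_iff [IsManifold (𝓡∂ 2) ∞ M]
    {e : OpenPartialHomeomorph M (EuclideanHalfSpace 2)}
    (he : e ∈ atlas (EuclideanHalfSpace 2) M) {q : M} (hq : q ∈ e.source) :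
    q ∈ (𝓡∂ 2).boundary M ↔ e.extend (𝓡∂ 2) q 0 = 0 := by
  have hx : e.extend (𝓡∂ 2) q ∈ (e.extend (𝓡∂ 2)).target :=
    (e.extend (𝓡∂ 2)).map_source (by rwa [e.extend_source])
  have h1 := mem_interior_target_iff hx
  rw [← (𝓡∂ 2).isInteriorPoint_iff_of_mem_atlas (n := ∞) (by simp) he hq,
    (𝓡∂ 2).isInteriorPoint_iff_not_isBoundaryPoint] at h1
  exact not_iff_not.1 h1

variable {r : ℝ}

lemma IsCompactStationary.exists_isLocalModel {α : ℝ} (h : IsCompactStationary α f)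
    (hr : ∀ q, ‖f q‖ = r) (p : M) : ∃ φ ψ g A, IsLocalModel f p φ ψ g A := by
  have hM := h.isManifold
  set e := chartAt (EuclideanHalfSpace 2) p with he
  have hat : e ∈ atlas (EuclideanHalfSpace 2) M := chart_mem_atlas _ p
  have hmem : e ∈ IsManifold.maximalAtlas (𝓡∂ 2) ∞ M := IsManifold.chart_mem_maximalAtlas p
  have hp : p ∈ e.source := mem_chart_source _ p
  set φ := e.extend (𝓡∂ 2) with hφ
  have hsrc : φ.source = e.source := e.extend_source
  have hx₀ : φ p ∈ φ.target := φ.map_source (by rwa [hsrc])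
  have hx₀H : φ p ∈ halfPlane := e.extend_target_subset_range hx₀
  set X := localParam f e with hX
  have hXd := h.contDiffWithinAt_localParam hmem hx₀
  have hXφ : ∀ q ∈ e.source, X (φ q) = f q := fun q hq => by
    simp only [hX, localParam, Function.comp_apply]
    rw [← hφ, φ.left_inv (by rwa [hsrc])]
  refine ⟨φ, φ.symm, edgeExtension X (fderivWithin ℝ X halfPlane (φ p)),
    fderivWithin ℝ X halfPlane (φ p), ?_, ?_, ?_, ?_, ?_, ?_, ?_⟩
  · exact e.continuousAt_extend hp
  · filter_upwards [e.open_source.mem_nhds hp] with q hq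
    have hqH : φ q ∈ halfPlane := e.extend_target_subset_range (φ.map_source (by rwa [hsrc]))
    refine ⟨hqH, φ.left_inv (by rwa [hsrc]), ?_, mem_boundary_iff hat hq⟩
    rw [edgeExtension_of_mem _ _ hqH, hXφ q hq]
  · have := e.map_extend_symm_nhdsWithin_range (I := 𝓡∂ 2) hp
    exact this.le
  · filter_upwards [extend_target_mem_nhdsWithin' hx₀, self_mem_nhdsWithin] with x hx hxH
    refine ⟨(edgeExtension_of_mem X _ hxH).symm, fun h0 => ?_⟩
    have hs : φ.symm x ∈ e.source := hsrc ▸ φ.map_target hx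
    rw [mem_boundary_iff hat hs, ← hφ, φ.right_inv hx]
    exact h0
  · exact hasStrictFDerivAt_edgeExtension hXd hx₀H
  · exact h.injective_fderivWithin_localParam hmem hx₀
  · rw [← hXφ p hp]
    exact inner_fderivWithin_eq_zero (hXd.differentiableWithinAt (by simp)) hx₀H univ_mem
      (fun x _ => hr _)

variable {p : M} {φ : M → E2} {ψ : E2 → M} {g : E2 → E3} {A : E2 →L[ℝ] E3} {c v : E3}

lemma IsLocalModel.exists_injOn (h : IsLocalModel f p φ ψ g A) : ∃ U ∈ 𝓝 p, InjOn f U := by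
  obtain ⟨W, hW, hinj⟩ := HasStrictFDerivAt.exists_injOn h.strict h.injective
  refine ⟨_, inter_mem (h.continuousAt hW) h.near, fun q hq q' hq' hqq => ?_⟩
  obtain ⟨-, h1, h2, -⟩ := hq.2
  obtain ⟨-, h1', h2', -⟩ := hq'.2
  rw [← h1, ← h1', hinj hq.1 hq'.1 (by rw [h2, h2', hqq])]

lemma IsLocalModel.apply_eq (h : IsLocalModel f p φ ψ g A) : g (φ p) = f p :=
  h.near.self_of_nhds.2.2.1

lemma IsLocalModel.transversal (h : IsLocalModel f p φ ψ g A) (hr : ∀ q, ‖f q‖ = r)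
    (hc : ‖c‖ < r) : inner ℝ (f p) (g (φ p) - c) ≠ 0 := by
  rw [h.apply_eq, inner_sub_right, real_inner_self_eq_norm_sq, hr]
  have := real_inner_le_norm (f p) c
  rw [hr] at this
  have hr0 : 0 < r := (norm_nonneg c).trans_lt hc
  nlinarith

/-- The image of a neighbourhood covers the points of the sphere near `f p` which, in polar
coordinates, correspond to the half plane. -/
lemma IsLocalModel.nhdsWithin_le_map (h : IsLocalModel f p φ ψ g A) (hr : ∀ q, ‖f q‖ = r)
    (hc : ‖c‖ < r) {T : Set E3} (hT : T ⊆ Metric.sphere 0 r)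
    (hside : ∀ᶠ x in 𝓝 (φ p), ∀ ρ : ℝ, 0 < ρ → c + ρ • (g x - c) ∈ T → x ∈ halfPlane) :
    𝓝[T] (f p) ≤ map f (𝓝 p) := by
  intro V hV
  rw [mem_map] at hV
  have h1 : ∀ᶠ x in 𝓝 (φ p), x ∈ halfPlane → ψ x ∈ f ⁻¹' V :=
    eventually_nhdsWithin_iff.1 (h.tendsto hV)
  have h2 := polar_image_mem_nhds h.strict h.injective h.normal (h.transversal hr hc)
    (hside.and (h1.and (eventually_nhdsWithin_iff.1 h.near_symm)))
  rw [h.apply_eq] at h2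
  refine mem_nhdsWithin_iff_exists_mem_nhds_inter.2 ⟨_, h2, ?_⟩
  rintro y ⟨⟨x, ⟨hx1, hx2, hx3⟩, ρ, hρ, rfl⟩, hy⟩
  have hxH := hx1 ρ hρ hy
  obtain ⟨h3, -⟩ := hx3 hxH
  have h4 : ‖g x‖ = r := h3 ▸ hr _
  -- `g x` and the given point of the sphere lie on the same ray from `c`, so they coincide.
  have h5 : ρ = 1 := eq_one_of_norm_eq hc h4 hρ (by simpa using hT hy)
  subst h5
  rw [one_smul, add_sub_cancel, ← h3]
  exact hx2 hxH

lemma IsLocalModel.nhdsWithin_sphere_le_map (h : IsLocalModel f p φ ψ g A)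
    (hr : ∀ q, ‖f q‖ = r) (hc : ‖c‖ < r) (hp : p ∉ (𝓡∂ 2).boundary M) :
    𝓝[Metric.sphere 0 r] (f p) ≤ map f (𝓝 p) := by
  obtain ⟨h1, -, -, h2⟩ := h.near.self_of_nhds
  have h3 : 0 < φ p 0 := lt_of_le_of_ne (mem_halfPlane.1 h1) fun h0 => hp (h2.2 h0.symm)
  refine h.nhdsWithin_le_map hr hc subset_rfl ?_
  have hcont : ContinuousAt (fun x : E2 => x 0) (φ p) := by fun_prop
  filter_upwards [hcont.eventually (lt_mem_nhds h3)] with x hx ρ _ _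
  exact mem_halfPlane.2 hx.le

/-- Near a boundary point, if the boundary lies in the plane `⟨v, y - c⟩ = 0` and the inner
conormal points to the positive side, then the surface covers exactly the positive side. -/
lemma IsLocalModel.one_sided_of_pos (h : IsLocalModel f p φ ψ g A) (hr : ∀ q, ‖f q‖ = r)
    (hc : ‖c‖ < r) (hp : p ∈ (𝓡∂ 2).boundary M)
    (hb : ∀ q ∈ (𝓡∂ 2).boundary M, inner ℝ v (f q - c) = 0)
    (hκ : 0 < inner ℝ v (A (EuclideanSpace.single 0 1))) :
    (∀ᶠ q in 𝓝 p, q ∉ (𝓡∂ 2).boundary M → 0 < inner ℝ v (f q - c)) ∧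
      𝓝[Metric.sphere 0 r ∩ {y | 0 ≤ inner ℝ v (y - c)}] (f p) ≤ map f (𝓝 p) := by
  set κ := inner ℝ v (A (EuclideanSpace.single 0 1)) with hκdef
  set ζ : E2 → ℝ := fun x => inner ℝ v (g x - c) with hζ
  have hφp : φ p 0 = 0 := h.near.self_of_nhds.2.2.2.1 hp
  have hstrict : HasStrictFDerivAt ζ ((innerSL ℝ v).comp A) (φ p) :=
    (innerSL ℝ v).hasStrictFDerivAt.comp (φ p) (h.strict.sub_const c)
  rw [hasStrictFDerivAt_iff_isLittleO, Asymptotics.isLittleO_iff] at hstrict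
  have hedge : Tendsto (fun x : E2 => (x, (!₂[0, x 1] : E2))) (𝓝 (φ p)) (𝓝 (φ p, φ p)) := by
    have hcont : Continuous fun x : E2 => (x, (!₂[0, x 1] : E2)) := by fun_prop
    have := hcont.tendsto (φ p)
    have h0 : (!₂[0, φ p 1] : E2) = φ p := by
      ext i; fin_cases i <;> simp [hφp]
    rwa [h0] at this
  have hzero : ∀ᶠ x in 𝓝 (φ p), ζ !₂[0, x 1] = 0 := by
    have h1 := eventually_nhdsWithin_iff.1 h.near_symm
    have h2 := (continuous_snd.tendsto (φ p, φ p)).comp hedge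
    filter_upwards [h2.eventually h1] with x hx
    obtain ⟨h3, h4⟩ := hx (mem_halfPlane.2 (by simp))
    have h5 := hb _ (h4 (by simp))
    rwa [h3] at h5
  -- `x` is compared with its foot on the edge, where `ζ` vanishes. Strict differentiability makes
  -- the error relative to `|x 0|`; plain differentiability at `φ p` would only give an error
  -- relative to the distance to `φ p`.
  have hsign : ∀ᶠ x in 𝓝 (φ p), |ζ x - κ * x 0| ≤ κ / 2 * |x 0| := by
    filter_upwards [hedge.eventually (hstrict (half_pos hκ)), hzero] with x hx hx0
    have h1 : x - (!₂[0, x 1] : E2) = x 0 • EuclideanSpace.single 0 1 := by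
      ext i; fin_cases i <;> simp
    simp only [h1, hx0, sub_zero, ContinuousLinearMap.comp_apply, map_smul, innerSL_apply_apply,
      smul_eq_mul, norm_smul, Real.norm_eq_abs] at hx
    rw [← hκdef] at hx
    simpa [mul_comm (x 0) κ] using hx
  have hpos : ∀ᶠ x in 𝓝 (φ p), (0 < x 0 → 0 < ζ x) ∧ (x 0 < 0 → ζ x < 0) := by
    filter_upwards [hsign] with x hx
    rw [abs_le] at hx
    constructor
    · intro h0
      rw [abs_of_pos h0] at hx
      nlinarith
    · intro h0
      rw [abs_of_neg h0] at hx
      nlinarith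
  constructor
  · filter_upwards [h.near, h.continuousAt.eventually hpos] with q ⟨h1, h2, h3, h4⟩ h5 hq
    rw [← h3]
    exact h5.1 (lt_of_le_of_ne (mem_halfPlane.1 h1) fun h0 => hq (h4.2 h0.symm))
  · refine h.nhdsWithin_le_map hr hc inter_subset_left ?_
    filter_upwards [hpos] with x hx ρ hρ hT
    -- The reference plane passes through `c`, so moving along the ray from `c` multiplies the
    -- height by `ρ > 0` and keeps its sign.
    have h1 : 0 ≤ inner ℝ v (c + ρ • (g x - c) - c) := hT.2
    rw [add_sub_cancel_left, inner_smul_right] at h1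
    rw [mem_halfPlane]
    by_contra! h0
    have h2 : inner ℝ v (g x - c) < 0 := hx.2 h0
    nlinarith

/-- The edge maps into the plane, so `v` is orthogonal to the edge direction and to `f p - c`. If it
were also orthogonal to the conormal direction, it would be orthogonal to a spanning set of space.
-/
lemma IsLocalModel.conormal_ne_zero (h : IsLocalModel f p φ ψ g A) (hr : ∀ q, ‖f q‖ = r)
    (hc : ‖c‖ < r) (hv : v ≠ 0) (hp : p ∈ (𝓡∂ 2).boundary M)
    (hb : ∀ q ∈ (𝓡∂ 2).boundary M, inner ℝ v (f q - c) = 0) :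
    inner ℝ v (A (EuclideanSpace.single 0 1)) ≠ 0 := by
  intro h0
  have hφp : φ p 0 = 0 := h.near.self_of_nhds.2.2.2.1 hp
  have h1 : inner ℝ v (A (EuclideanSpace.single 1 1)) = 0 := by
    have hline : HasDerivAt (fun t : ℝ => φ p + t • (EuclideanSpace.single 1 1 : E2))
        (EuclideanSpace.single 1 1) 0 := by
      simpa using ((hasDerivAt_id (0 : ℝ)).smul_const (EuclideanSpace.single 1 1 : E2)).const_add
        (φ p)
    have hζ : HasFDerivAt (fun x => inner ℝ v (g x - c)) ((innerSL ℝ v).comp A)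
        (φ p + (0 : ℝ) • (EuclideanSpace.single 1 1 : E2)) := by
      rw [zero_smul, add_zero]
      exact (innerSL ℝ v).hasFDerivAt.comp (φ p) (h.strict.hasFDerivAt.sub_const c)
    have h2 := hζ.comp_hasDerivAt (0 : ℝ) hline
    have h3 : (fun t : ℝ => inner ℝ v (g (φ p + t • (EuclideanSpace.single 1 1 : E2)) - c))
        =ᶠ[𝓝 0] fun _ => 0 := by
      have h4 : Tendsto (fun t : ℝ => φ p + t • (EuclideanSpace.single 1 1 : E2)) (𝓝 0)
          (𝓝 (φ p)) := by
        simpa using hline.continuousAt.tendsto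
      filter_upwards [h4.eventually (eventually_nhdsWithin_iff.1 h.near_symm)] with t ht
      obtain ⟨h5, h6⟩ := ht (mem_halfPlane.2 (by simp [hφp]))
      rw [← h5]
      exact hb _ (h6 (by simp [hφp]))
    exact h2.unique ((hasDerivAt_const (0 : ℝ) (0 : ℝ)).congr_of_eventuallyEq h3)
  obtain ⟨ξ, τ, hξ⟩ := polar_surjective h.injective h.normal (h.transversal hr hc) v
  refine hv (inner_self_eq_zero (𝕜 := ℝ).1 ?_)
  nth_rewrite 2 [← hξ]
  rw [inner_add_right, clm_apply_eq A ξ, inner_add_right, inner_smul_right, inner_smul_right,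
    inner_smul_right, h0, h1, h.apply_eq, hb p hp]
  ring

lemma IsLocalModel.one_sided (h : IsLocalModel f p φ ψ g A) (hr : ∀ q, ‖f q‖ = r)
    (hc : ‖c‖ < r) (hv : v ≠ 0) (hp : p ∈ (𝓡∂ 2).boundary M)
    (hb : ∀ q ∈ (𝓡∂ 2).boundary M, inner ℝ v (f q - c) = 0) :
    ∃ w, (w = v ∨ w = -v) ∧ (∀ᶠ q in 𝓝 p, q ∉ (𝓡∂ 2).boundary M → 0 < inner ℝ w (f q - c)) ∧
      𝓝[Metric.sphere 0 r ∩ {y | 0 ≤ inner ℝ w (y - c)}] (f p) ≤ map f (𝓝 p) := by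
  rcases lt_or_gt_of_ne (h.conormal_ne_zero hr hc hv hp hb) with h0 | h0
  · exact ⟨-v, Or.inr rfl, h.one_sided_of_pos hr hc hp (fun q hq => by simp [hb q hq])
      (by simpa using h0)⟩
  · exact ⟨v, Or.inl rfl, h.one_sided_of_pos hr hc hp hb h0⟩

end LocalStructure

/-! ### Stereographic parametrizations of the sphere -/

section Stereo

variable (b : OrthonormalBasis (Fin 3) ℝ E3) (r a : ℝ)

/-- An affine parametrization of the plane `⟨b 0, y⟩ = -1 / (2 r)`. -/
noncomputable def stereoPlane (x : E2) : E3 :=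
  (-(1 / (2 * r))) • b 0 + (x 0 + a) • b 1 + x 1 • b 2

/-- The stereographic parametrization of the sphere of radius `r` with pole `r • b 0`: the plane
`stereoPlane`, followed by the inversion with centre at the pole. -/
noncomputable def stereo (x : E2) : E3 :=
  r • b 0 + (‖stereoPlane b r a x‖ ^ 2)⁻¹ • stereoPlane b r a x

/-- The stereographic projection, inverse to `stereo`. -/
noncomputable def stereoInv (y : E3) : E2 :=
  !₂[inner ℝ (b 1) ((‖y - r • b 0‖ ^ 2)⁻¹ • (y - r • b 0)) - a,
    inner ℝ (b 2) ((‖y - r • b 0‖ ^ 2)⁻¹ • (y - r • b 0))]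

lemma inner_basis (i j : Fin 3) : inner ℝ (b i) (b j) = if i = j then (1 : ℝ) else 0 :=
  orthonormal_iff_ite.1 b.orthonormal i j

variable {b r a}

lemma inner_basis_stereoPlane (x : E2) :
    inner ℝ (b 0) (stereoPlane b r a x) = -(1 / (2 * r)) ∧
    inner ℝ (b 1) (stereoPlane b r a x) = x 0 + a ∧
    inner ℝ (b 2) (stereoPlane b r a x) = x 1 := by
  simp [stereoPlane, inner_add_right, inner_smul_right]

lemma norm_sq_eq_basis (y : E3) :
    ‖y‖ ^ 2 = inner ℝ (b 0) y ^ 2 + inner ℝ (b 1) y ^ 2 + inner ℝ (b 2) y ^ 2 := by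
  rw [← b.sum_sq_norm_inner_right y, Fin.sum_univ_three]
  simp

lemma norm_sq_stereoPlane (x : E2) :
    ‖stereoPlane b r a x‖ ^ 2 = (1 / (2 * r)) ^ 2 + (x 0 + a) ^ 2 + x 1 ^ 2 := by
  obtain ⟨h0, h1, h2⟩ := inner_basis_stereoPlane (b := b) (r := r) (a := a) x
  rw [norm_sq_eq_basis (b := b), h0, h1, h2]; ring

lemma norm_sq_stereoPlane_pos (hr : 0 < r) (x : E2) : 0 < ‖stereoPlane b r a x‖ ^ 2 := by
  rw [norm_sq_stereoPlane]; positivity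

lemma eq_stereoPlane {P : E3} (h : inner ℝ (b 0) P = -(1 / (2 * r))) :
    stereoPlane b r a !₂[inner ℝ (b 1) P - a, inner ℝ (b 2) P] = P := by
  conv_rhs => rw [← b.sum_repr' P, Fin.sum_univ_three, h]
  simp [stereoPlane]

/-- The offset `-1 / (2r)` of the plane makes the cross term `2r⟨b 0, P⟩ / |P|²` cancel `1 / |P|²`.
-/
lemma norm_stereo (hr : 0 < r) (x : E2) : ‖stereo b r a x‖ = r := by
  have hP := norm_sq_stereoPlane_pos (b := b) (a := a) hr x
  obtain ⟨h0, -, -⟩ := inner_basis_stereoPlane (b := b) (r := r) (a := a) x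
  have h1 : ‖b 0‖ = 1 := b.orthonormal.1 0
  have h : ‖stereo b r a x‖ ^ 2 = r ^ 2 := by
    rw [stereo, norm_add_sq_real, norm_smul, norm_smul, h1, inner_smul_left, inner_smul_right, h0,
      mul_pow, mul_pow, Real.norm_eq_abs, sq_abs, Real.norm_eq_abs, sq_abs]
    simp only [conj_trivial]
    field_simp
    ring
  exact (sq_eq_sq₀ (norm_nonneg _) hr.le).1 h

lemma stereo_sub (x : E2) :
    stereo b r a x - r • b 0 = (‖stereoPlane b r a x‖ ^ 2)⁻¹ • stereoPlane b r a x := by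
  rw [stereo, add_sub_cancel_left]

lemma stereo_ne (hr : 0 < r) (x : E2) : stereo b r a x ≠ r • b 0 := by
  have hP := norm_sq_stereoPlane_pos (b := b) (a := a) hr x
  rw [← sub_ne_zero, stereo_sub]
  refine smul_ne_zero (inv_ne_zero hP.ne') fun h0 => ?_
  rw [h0] at hP
  simp at hP

lemma inversion_inversion {E : Type*} [NormedAddCommGroup E] [InnerProductSpace ℝ E] (P : E) :
    (‖(‖P‖ ^ 2)⁻¹ • P‖ ^ 2)⁻¹ • (‖P‖ ^ 2)⁻¹ • P = P := by
  by_cases hP : P = 0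
  · simp [hP]
  · have : ‖P‖ ≠ 0 := norm_ne_zero_iff.2 hP
    rw [norm_smul, norm_inv, norm_pow, norm_norm, smul_smul]
    have : ((‖P‖ ^ 2)⁻¹ * ‖P‖) ^ 2 = (‖P‖ ^ 2)⁻¹ := by field_simp
    rw [this, inv_inv, mul_inv_cancel₀ (by positivity), one_smul]

lemma stereoInv_stereo (x : E2) : stereoInv b r a (stereo b r a x) = x := by
  obtain ⟨-, h1, h2⟩ := inner_basis_stereoPlane (b := b) (r := r) (a := a) x
  rw [stereoInv, stereo_sub, inversion_inversion, h1, h2]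
  ext i
  fin_cases i <;> simp

/-- On the sphere `|y - r b 0|² = -2r⟨b 0, y - r b 0⟩`, so the inversion about the pole lands in the
parameter plane. -/
lemma stereo_stereoInv (hr : 0 < r) {y : E3} (hy : ‖y‖ = r) (hne : y ≠ r • b 0) :
    stereo b r a (stereoInv b r a y) = y := by
  have hpos : 0 < ‖y - r • b 0‖ ^ 2 := by
    have := sub_ne_zero.2 hne
    positivity
  have h1 : ‖b 0‖ = 1 := b.orthonormal.1 0
  have hsq : ‖y - r • b 0‖ ^ 2 = 2 * r ^ 2 - 2 * r * inner ℝ (b 0) y := by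
    rw [norm_sub_sq_real, norm_smul, h1, hy, inner_smul_right, real_inner_comm (b 0), mul_pow,
      Real.norm_eq_abs, sq_abs]
    ring
  have hP : inner ℝ (b 0) ((‖y - r • b 0‖ ^ 2)⁻¹ • (y - r • b 0)) = -(1 / (2 * r)) := by
    rw [inner_smul_right, inner_sub_right, inner_smul_right, real_inner_self_eq_norm_sq, h1]
    rw [hsq] at hpos ⊢
    rw [inv_mul_eq_iff_eq_mul₀ hpos.ne']
    field_simp
    ring
  rw [stereo, stereoInv, eq_stereoPlane hP, inversion_inversion, add_sub_cancel]

variable (b r a)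

lemma contDiff_stereo (hr : 0 < r) : ContDiff ℝ ∞ (stereo b r a) := by
  have h : ContDiff ℝ ∞ (stereoPlane b r a) := by
    unfold stereoPlane
    have h0 : ContDiff ℝ ∞ fun x : E2 => x 0 :=
      (EuclideanSpace.proj 0 : E2 →L[ℝ] ℝ).contDiff
    have h1 : ContDiff ℝ ∞ fun x : E2 => x 1 :=
      (EuclideanSpace.proj 1 : E2 →L[ℝ] ℝ).contDiff
    fun_prop
  unfold stereo
  exact contDiff_const.add (((h.norm_sq ℝ).inv fun x =>
    (norm_sq_stereoPlane_pos hr x).ne').smul h)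

lemma contDiffOn_stereoInv : ContDiffOn ℝ ∞ (stereoInv b r a) {r • b 0}ᶜ := by
  have h : ContDiffOn ℝ ∞ (fun y : E3 => (‖y - r • b 0‖ ^ 2)⁻¹ • (y - r • b 0)) {r • b 0}ᶜ := by
    have h1 : ContDiff ℝ ∞ fun y : E3 => y - r • b 0 := contDiff_id.sub contDiff_const
    refine (((h1.norm_sq ℝ).contDiffOn).inv fun y hy => ?_).smul h1.contDiffOn
    have : y - r • b 0 ≠ 0 := sub_ne_zero.2 hy
    simpa using this
  unfold stereoInv
  rw [contDiffOn_piLp]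
  intro i
  fin_cases i
  · exact (contDiffOn_const.inner ℝ h).sub contDiffOn_const
  · exact contDiffOn_const.inner ℝ h

/-- The numerator is affine in `x`: planes through the pole correspond to lines of parameters. -/
lemma inner_stereo_sub {v : E3} (x : E2) :
    inner ℝ v (stereo b r a x - r • b 0) = (inner ℝ v (b 0) * (-(1 / (2 * r))) +
      inner ℝ v (b 1) * (x 0 + a) + inner ℝ v (b 2) * x 1) /
        ‖stereoPlane b r a x‖ ^ 2 := by
  rw [stereo_sub, inner_smul_right]
  simp only [stereoPlane, inner_add_right, inner_smul_right]
  ring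

end Stereo

/-- A spherical cap is parametrized by a closed disc. -/
lemma exists_disc_parametrization {c v : E3} {r : ℝ} (hc : ‖c‖ < r) (hv : v ≠ 0) :
    ∃ (R : ℝ) (Φ : E2 → E3), 0 < R ∧ Continuous Φ ∧ Function.Injective Φ ∧
      Φ '' Metric.closedBall 0 R = Metric.sphere 0 r ∩ {y | 0 ≤ inner ℝ v (y - c)} ∧
      ∀ x, inner ℝ v (Φ x - c) = 0 ↔ x ∈ Metric.sphere 0 R := by
  have hr : 0 < r := (norm_nonneg c).trans_lt hc
  have hvpos : 0 < ‖v‖ := norm_pos_iff.2 hv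
  -- The pole is placed opposite to `v`, outside the cap, so that the cap has bounded parameters.
  set u : E3 := -(‖v‖⁻¹ • v) with hu
  have hu1 : ‖u‖ = 1 := by
    rw [hu, norm_neg, norm_smul, norm_inv, norm_norm, inv_mul_cancel₀ hvpos.ne']
  obtain ⟨b, hb⟩ := Orthonormal.exists_orthonormalBasis_extension_of_card_eq (𝕜 := ℝ) (E := E3)
    (ι := Fin 3) (v := fun _ => u) (s := {0}) (by simp) (by
      rw [orthonormal_iff_ite]
      rintro ⟨i, hi⟩ ⟨j, hj⟩
      obtain rfl : i = 0 := hi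
      obtain rfl : j = 0 := hj
      simp [hu1])
  have hb0 : b 0 = u := hb 0 rfl
  have hvu : v = (-‖v‖) • b 0 := by
    rw [hb0, hu, smul_neg, neg_smul, neg_neg, smul_smul, mul_inv_cancel₀ hvpos.ne', one_smul]
  have hv0 : inner ℝ v (b 0) = -‖v‖ := by
    conv_lhs => rw [hvu]
    rw [inner_smul_left, inner_basis]; simp
  have hv1 : inner ℝ v (b 1) = 0 := by rw [hvu, inner_smul_left, inner_basis]; simp
  have hv2 : inner ℝ v (b 2) = 0 := by rw [hvu, inner_smul_left, inner_basis]; simp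
  have hcv : |inner ℝ v c| < ‖v‖ * r :=
    (abs_real_inner_le_norm v c).trans_lt (mul_lt_mul_of_pos_left hc hvpos)
  rw [abs_lt] at hcv
  -- `-k` is the height of the pole, and `2r‖v‖ - k` that of its antipode. Both `k` and the latter
  -- are positive because the plane cuts the interior of the ball.
  set k := r * ‖v‖ + inner ℝ v c with hk
  have hkpos : 0 < k := by rw [hk]; linarith
  have hk2 : k < 2 * r * ‖v‖ := by rw [hk]; linarith
  set R2 := ‖v‖ / (2 * r) / k - (1 / (2 * r)) ^ 2 with hR2
  have hR2pos : 0 < R2 := by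
    have : R2 = (2 * r * ‖v‖ - k) / (4 * r ^ 2 * k) := by rw [hR2]; field_simp; ring
    rw [this]
    exact div_pos (by linarith) (by positivity)
  have hinner : ∀ x, inner ℝ v (stereo b r 0 x - c) =
      k * (R2 - ‖x‖ ^ 2) / ‖stereoPlane b r 0 x‖ ^ 2 := by
    intro x
    have hP := norm_sq_stereoPlane_pos (b := b) (a := 0) hr x
    have h1 : stereo b r 0 x - c = (stereo b r 0 x - r • b 0) + (r • b 0 - c) := by abel
    have h2 : ‖x‖ ^ 2 = x 0 ^ 2 + x 1 ^ 2 := by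
      have := dist_sq_eq x 0
      simpa using this
    rw [h1, inner_add_right, inner_stereo_sub, inner_sub_right, inner_smul_right, hv0, hv1, hv2]
    rw [eq_div_iff hP.ne', add_mul, div_mul_cancel₀ _ hP.ne', h2, norm_sq_stereoPlane, hR2]
    have : inner ℝ v c = k - r * ‖v‖ := by rw [hk]; ring
    rw [this]
    field_simp
    ring
  have hmem : ∀ x : E2, ∀ y : E3, y = stereo b r 0 x →
      (0 ≤ inner ℝ v (y - c) ↔ x ∈ Metric.closedBall 0 (Real.sqrt R2)) := by
    rintro x _ rfl
    have hP := norm_sq_stereoPlane_pos (b := b) (a := 0) hr x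
    rw [hinner, Metric.mem_closedBall, dist_zero_right, Real.le_sqrt (norm_nonneg _) hR2pos.le,
      le_div_iff₀ hP, zero_mul, mul_nonneg_iff_of_pos_left hkpos, sub_nonneg]
  refine ⟨Real.sqrt R2, stereo b r 0, Real.sqrt_pos.2 hR2pos, (contDiff_stereo b r 0 hr).continuous,
    Function.LeftInverse.injective stereoInv_stereo, ?_, ?_⟩
  · ext y
    constructor
    · rintro ⟨x, hx, rfl⟩
      exact ⟨by simpa using norm_stereo hr x, (hmem x _ rfl).2 hx⟩
    · rintro ⟨hy, hy2⟩
      have hy' : ‖y‖ = r := by simpa using hy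
      have hne : y ≠ r • b 0 := by
        rintro rfl
        have h3 : 0 ≤ inner ℝ v (r • b 0 - c) := hy2
        rw [inner_sub_right, inner_smul_right, hv0] at h3
        linarith
      refine ⟨stereoInv b r 0 y, ?_, stereo_stereoInv hr hy' hne⟩
      exact (hmem _ y (stereo_stereoInv hr hy' hne).symm).1 hy2
  · intro x
    have hP := norm_sq_stereoPlane_pos (b := b) (a := 0) hr x
    rw [hinner, div_eq_zero_iff, or_iff_left hP.ne', mul_eq_zero, or_iff_right hkpos.ne',
      sub_eq_zero, Metric.mem_sphere, dist_zero_right]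
    constructor
    · intro h
      rw [h, Real.sqrt_sq (norm_nonneg x)]
    · intro h
      rw [h, Real.sq_sqrt hR2pos.le]

/-! ### Surfaces in a sphere bounded by a circle -/

/-- The part of the sphere of radius `r` on the side of `v` of the plane through `c` orthogonal
to `v`. -/
def sphereSide (r : ℝ) (c v : E3) : Set E3 := Metric.sphere 0 r ∩ {y | 0 ≤ inner ℝ v (y - c)}

/-- The points of the sphere on a plane which cuts its interior are limits of points of the sphere
on the positive side. -/
lemma exists_pos_mem_nhds {r : ℝ} {c v y₀ : E3} (hc : ‖c‖ < r) (hv : v ≠ 0) (hy₀ : ‖y₀‖ = r)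
    (h0 : inner ℝ v (y₀ - c) = 0) {T : Set E3} (hT : T ∈ 𝓝[Metric.sphere 0 r] y₀) :
    ∃ y ∈ T, ‖y‖ = r ∧ 0 < inner ℝ v (y - c) := by
  have hr : 0 < r := (norm_nonneg c).trans_lt hc
  -- The tangential part of `v` at `y₀`. It is nonzero: otherwise the plane would be tangent to the
  -- sphere at `y₀`, which is impossible with `c` inside. The great circle leaving `y₀` along `w`
  -- then climbs to the positive side.
  set w : E3 := v - (inner ℝ v y₀ / r ^ 2) • y₀ with hw
  have hwy : inner ℝ w y₀ = 0 := by
    rw [hw, inner_sub_left, inner_smul_left, real_inner_self_eq_norm_sq, hy₀]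
    simp only [conj_trivial]
    field_simp
    ring
  have hvw : inner ℝ v w = ‖w‖ ^ 2 := by
    have : v = w + (inner ℝ v y₀ / r ^ 2) • y₀ := by rw [hw]; abel
    conv_lhs => rw [this]
    rw [inner_add_left, inner_smul_left, real_inner_comm, real_inner_comm w y₀, hwy,
      real_inner_self_eq_norm_sq]
    simp
  have hw0 : w ≠ 0 := by
    intro hw0
    have hvy : v = (inner ℝ v y₀ / r ^ 2) • y₀ := sub_eq_zero.1 hw0
    have hne : inner ℝ v y₀ / r ^ 2 ≠ 0 := fun h => hv (by rw [hvy, h, zero_smul])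
    rw [hvy, inner_smul_left, inner_sub_right, real_inner_self_eq_norm_sq, hy₀] at h0
    have h1 := (mul_eq_zero.1 h0).resolve_left (by simpa using hne)
    have h2 := real_inner_le_norm y₀ c
    rw [hy₀] at h2
    nlinarith
  have hwpos : 0 < ‖w‖ := norm_pos_iff.2 hw0
  set γ : ℝ → E3 := fun t => Real.cos t • y₀ + (Real.sin t * (r / ‖w‖)) • w with hγ
  have hγr : ∀ t, ‖γ t‖ = r := by
    intro t
    have h1 : ‖γ t‖ ^ 2 = r ^ 2 := by
      rw [hγ]
      simp only
      rw [norm_add_sq_real, norm_smul, norm_smul, inner_smul_left, inner_smul_right,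
        real_inner_comm, hwy, hy₀, mul_pow, mul_pow, Real.norm_eq_abs, Real.norm_eq_abs, sq_abs,
        sq_abs]
      field_simp
      linear_combination (r * ‖w‖) * Real.sin_sq_add_cos_sq t
    exact (sq_eq_sq₀ (norm_nonneg _) hr.le).1 h1
  have hγ0 : γ 0 = y₀ := by simp [hγ]
  have hγc : Continuous γ := by fun_prop
  have hd : HasDerivAt (fun t => inner ℝ v (γ t - c)) (r * ‖w‖) 0 := by
    have h1 : (fun t => inner ℝ v (γ t - c)) = fun t =>
        Real.cos t * inner ℝ v y₀ + Real.sin t * (r * ‖w‖) - inner ℝ v c := by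
      funext t
      rw [hγ, inner_sub_right, inner_add_right, inner_smul_right, inner_smul_right, hvw]
      field_simp
    rw [h1]
    have h2 := (((Real.hasDerivAt_cos 0).mul_const (inner ℝ v y₀)).add
      ((Real.hasDerivAt_sin 0).mul_const (r * ‖w‖))).sub_const (inner ℝ v c)
    simpa using h2
  have hpos : ∀ᶠ t in 𝓝[>] (0 : ℝ), 0 < inner ℝ v (γ t - c) := by
    have h1 := hd.hasDerivWithinAt (s := Ioi 0)
    have h2 := (hasDerivWithinAt_iff_tendsto_slope' (by simp)).1 h1
    filter_upwards [h2.eventually (lt_mem_nhds (by positivity : (0 : ℝ) < r * ‖w‖)),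
      self_mem_nhdsWithin] with t ht ht0
    rw [slope_def_field, hγ0, h0, sub_zero, sub_zero] at ht
    exact (div_pos_iff_of_pos_right ht0).1 ht
  have hmem : ∀ᶠ t in 𝓝[>] (0 : ℝ), γ t ∈ T := by
    have h1 : Tendsto γ (𝓝[>] 0) (𝓝[Metric.sphere 0 r] y₀) := by
      refine tendsto_nhdsWithin_iff.2 ⟨?_, Eventually.of_forall fun t => by simp [hγr t]⟩
      rw [← hγ0]
      exact (hγc.tendsto 0).mono_left nhdsWithin_le_nhds
    exact h1 hT
  obtain ⟨t, ht1, ht2⟩ := (hpos.and hmem).exists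
  exact ⟨γ t, ht2, hγr t, ht1⟩

/-- A map into a sphere with the local properties of an immersion of a surface with boundary `B`
mapped into a plane. -/
structure IsSphericalDomain {M : Type*} [TopologicalSpace M] (f : M → E3) (B : Set M) (r : ℝ)
    (c v : E3) : Prop where
  norm_lt : ‖c‖ < r
  ne_zero : v ≠ 0
  continuous : Continuous f
  isClosed : IsClosed B
  norm_eq : ∀ q, ‖f q‖ = r
  injOn : ∀ p, ∃ U ∈ 𝓝 p, InjOn f U
  interior : ∀ p ∉ B, 𝓝[Metric.sphere 0 r] (f p) ≤ map f (𝓝 p)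
  plane : ∀ p ∈ B, inner ℝ v (f p - c) = 0
  boundary : ∀ p ∈ B, ∃ w, (w = v ∨ w = -v) ∧ (∀ᶠ q in 𝓝 p, q ∉ B → 0 < inner ℝ w (f q - c)) ∧
      𝓝[sphereSide r c w] (f p) ≤ map f (𝓝 p)

namespace IsSphericalDomain

variable {M : Type*} [TopologicalSpace M] {f : M → E3} {B : Set M} {r : ℝ} {c v : E3}

lemma neg (h : IsSphericalDomain f B r c v) : IsSphericalDomain f B r c (-v) where
  norm_lt := h.norm_lt
  ne_zero := neg_ne_zero.2 h.ne_zero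
  continuous := h.continuous
  isClosed := h.isClosed
  norm_eq := h.norm_eq
  injOn := h.injOn
  interior := h.interior
  plane p hp := by rw [inner_neg_left, h.plane p hp, neg_zero]
  boundary p hp := by
    obtain ⟨w, hw, h'⟩ := h.boundary p hp
    exact ⟨w, by rw [neg_neg]; exact hw.symm, h'⟩

/-- The closure of the part of the surface on the positive side. -/
def side (f : M → E3) (c v : E3) : Set M := closure {q | 0 < inner ℝ v (f q - c)}

lemma continuous_height (h : IsSphericalDomain f B r c v) :
    Continuous fun q => inner ℝ v (f q - c) := by
  have := h.continuous
  fun_prop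

lemma mapsTo (h : IsSphericalDomain f B r c v) : MapsTo f (side f c v) (sphereSide r c v) := by
  intro q hq
  refine ⟨by simpa using h.norm_eq q, ?_⟩
  exact closure_minimal (fun q (hq : 0 < _) => hq.le)
    (isClosed_le continuous_const h.continuous_height) hq

lemma frequently_pos (h : IsSphericalDomain f B r c v) {q : M}
    (hq : 𝓝[sphereSide r c v] (f q) ≤ map f (𝓝 q)) (h0 : inner ℝ v (f q - c) = 0) {V : Set M}
    (hV : V ∈ 𝓝 q) : ∃ q' ∈ V, 0 < inner ℝ v (f q' - c) := by
  have h1 := hq (image_mem_map hV)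
  obtain ⟨T, hT, hTV⟩ := mem_nhdsWithin_iff_exists_mem_nhds_inter.1 h1
  obtain ⟨y, hy, hyr, hpos⟩ := exists_pos_mem_nhds h.norm_lt h.ne_zero (h.norm_eq q) h0
    (mem_nhdsWithin_of_mem_nhds hT)
  obtain ⟨q', hq', rfl⟩ := hTV ⟨hy, by simpa using hyr, hpos.le⟩
  exact ⟨q', hq', hpos⟩

lemma mem_side_of_le_map (h : IsSphericalDomain f B r c v) {q : M}
    (hq : 𝓝[sphereSide r c v] (f q) ≤ map f (𝓝 q)) (h0 : inner ℝ v (f q - c) = 0) :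
    q ∈ side f c v := by
  refine mem_closure_iff_nhds.2 fun V hV => ?_
  obtain ⟨q', hq', hpos⟩ := h.frequently_pos hq h0 hV
  exact ⟨q', hq', hpos⟩

lemma mem_side_of_notMem (h : IsSphericalDomain f B r c v) {q : M} (hq : q ∉ B)
    (h0 : 0 ≤ inner ℝ v (f q - c)) : q ∈ side f c v := by
  rcases h0.eq_or_lt with h0 | h0
  · exact h.mem_side_of_le_map ((nhdsWithin_mono _ inter_subset_left).trans (h.interior q hq))
      h0.symm
  · exact subset_closure h0

/-- Boundary points in the closure of the positive side are one-sided towards this side. -/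
lemma boundary_side (h : IsSphericalDomain f B r c v) {p : M} (hp : p ∈ B)
    (hps : p ∈ side f c v) : (∀ᶠ q in 𝓝 p, q ∉ B → 0 < inner ℝ v (f q - c)) ∧
      𝓝[sphereSide r c v] (f p) ≤ map f (𝓝 p) := by
  obtain ⟨w, rfl | rfl, h1, h2⟩ := h.boundary p hp
  · exact ⟨h1, h2⟩
  · exfalso
    obtain ⟨q, hq, hq'⟩ := mem_closure_iff_nhds.1 hps _ h1
    have hq'' : 0 < inner ℝ v (f q - c) := hq'
    have hqB : q ∉ B := fun hqB => hq''.ne' (h.plane q hqB)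
    have := hq hqB
    rw [inner_neg_left] at this
    linarith

/-- Near `p` all non-boundary points have positive height. A nearby boundary point facing the other
side would have points of negative height close to it, necessarily outside `B`, a contradiction. -/
lemma side_mem_nhds (h : IsSphericalDomain f B r c v) {p : M} (hp : p ∈ B)
    (hps : p ∈ side f c v) : side f c v ∈ 𝓝 p := by
  have h1 := (h.boundary_side hp hps).1
  filter_upwards [h1.eventually_nhds] with q hq
  by_cases hqB : q ∈ B
  · obtain ⟨w, rfl | rfl, -, h3⟩ := h.boundary q hqB
    · exact h.mem_side_of_le_map h3 (h.plane q hqB)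
    · exfalso
      obtain ⟨q', hq', hpos⟩ := h.neg.frequently_pos h3 (h.neg.plane q hqB) hq
      rw [inner_neg_left] at hpos
      by_cases hqB' : q' ∈ B
      · rw [h.plane q' hqB'] at hpos; simp at hpos
      · have := hq' hqB'
        linarith
  · exact subset_closure (hq.self_of_nhds hqB)

/-- This is openness of `f` from the closed side to the closed cap. Off `B` the surface covers a
full neighbourhood in the sphere, and preimages of nonnegative height that avoid `B` lie in the
side; hence the intersection with the complement of `B`. -/
lemma le_map_side (h : IsSphericalDomain f B r c v) {p : M} (hp : p ∈ side f c v) :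
    𝓝[sphereSide r c v] (f p) ≤ map f (𝓝[side f c v] p) := by
  by_cases hpB : p ∈ B
  · rw [nhdsWithin_eq_nhds.2 (h.side_mem_nhds hpB hp)]
    exact (h.boundary_side hpB hp).2
  · intro V hV
    rw [mem_map, mem_nhdsWithin_iff_exists_mem_nhds_inter] at hV
    obtain ⟨V₀, hV₀, hV⟩ := hV
    have h1 := h.interior p hpB
      (image_mem_map (inter_mem hV₀ (h.isClosed.isOpen_compl.mem_nhds hpB)))
    have h2 := nhdsWithin_mono (f p) (inter_subset_left : sphereSide r c v ⊆ _) h1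
    filter_upwards [h2, self_mem_nhdsWithin] with y hy hyS
    obtain ⟨q, ⟨hq, hqB⟩, rfl⟩ := hy
    exact hV ⟨hq, h.mem_side_of_notMem hqB hyS.2⟩

lemma isLocalHomeomorph_restrict (h : IsSphericalDomain f B r c v) :
    IsLocalHomeomorph h.mapsTo.restrict := by
  have hcont : Continuous h.mapsTo.restrict := h.continuous.restrict h.mapsTo
  have hopen : IsOpenMap h.mapsTo.restrict := by
    rw [isOpenMap_iff_nhds_le]
    rintro ⟨p, hp⟩ V hV
    rw [mem_map, mem_nhds_subtype_iff_nhdsWithin] at hV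
    rw [mem_nhds_subtype_iff_nhdsWithin]
    refine mem_of_superset (h.le_map_side hp (image_mem_map hV)) ?_
    rintro _ ⟨q, ⟨q', hq', rfl⟩, rfl⟩
    exact ⟨MapsTo.restrict _ _ _ h.mapsTo q', hq', rfl⟩
  rw [isLocalHomeomorph_iff_isOpenEmbedding_restrict]
  rintro ⟨p, hp⟩
  obtain ⟨U, hU, hinj⟩ := h.injOn p
  obtain ⟨V, hVU, hV, hpV⟩ := mem_nhds_iff.1 hU
  refine ⟨Subtype.val ⁻¹' V, (hV.preimage continuous_subtype_val).mem_nhds hpV, ?_⟩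
  refine .of_continuous_injective_isOpenMap (hcont.comp continuous_subtype_val) ?_
    (hopen.domRestrict (hV.preimage continuous_subtype_val))
  rintro ⟨⟨q, hq⟩, hqV⟩ ⟨⟨q', hq'⟩, hqV'⟩ heq
  have h1 : f q = f q' := congrArg (fun z : sphereSide r c v => (z : E3)) heq
  have h2 := hinj (hVU hqV) (hVU hqV') h1
  subst h2
  rfl

/-- If some boundary point is one-sided towards the positive side, then the surface is exactly the
cap on this side. -/
theorem injective_and_range_of_mem [CompactSpace M] [T2Space M] [PreconnectedSpace M]
    (h : IsSphericalDomain f B r c v) {p₀ : M} (hp₀ : p₀ ∈ B) (hp₀s : p₀ ∈ side f c v) :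
    Function.Injective f ∧ range f = sphereSide r c v := by
  obtain ⟨R, Φ, hR, hΦc, hΦi, hΦim, hΦs⟩ := exists_disc_parametrization h.norm_lt h.ne_zero
  have hmapsK : MapsTo Φ (Metric.closedBall 0 R) (sphereSide r c v) := fun x hx => by
    exact hΦim.subset (mem_image_of_mem Φ hx)
  set K : Set E2 := Metric.closedBall 0 R with hK
  have hKconv : Convex ℝ K := convex_closedBall 0 R
  have : CompactSpace K := isCompact_iff_compactSpace.1 (isCompact_closedBall 0 R)
  have : CompactSpace (side f c v) := isCompact_iff_compactSpace.1 isClosed_closure.isCompact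
  have : LocallyPathConnectedSpace K := hKconv.locallyPathConnectedSpace
  have : ContractibleSpace K := hKconv.contractibleSpace ⟨0, by simp [hK, hR.le]⟩
  set Φ' : C(K, sphereSide r c v) := ⟨hmapsK.restrict, hΦc.continuousOn.mapsToRestrict hmapsK⟩
    with hΦ'
  have hΦ'val : ∀ x : K, ((Φ' x : sphereSide r c v) : E3) = Φ x := fun x => rfl
  have hΦ'bij : Function.Bijective Φ' := by
    refine ⟨fun x y hxy => Subtype.ext (hΦi ?_), fun y => ?_⟩
    · rw [← hΦ'val, ← hΦ'val, hxy]
    · obtain ⟨x, hx, hxy⟩ := hΦim.superset y.2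
      exact ⟨⟨x, hx⟩, Subtype.ext hxy⟩
  have hΦ'homeo : IsHomeomorph Φ' :=
    isHomeomorph_iff_continuous_bijective.2 ⟨Φ'.continuous, hΦ'bij⟩
  have hloc := h.isLocalHomeomorph_restrict
  -- Compactness of the side upgrades the local homeomorphism to a covering.
  have hcov : IsCoveringMap h.mapsTo.restrict := isLocalHomeomorph_iff_isCoveringMap.1 hloc
  obtain ⟨a₀, ha₀⟩ := hΦ'bij.2 (MapsTo.restrict _ _ _ h.mapsTo ⟨p₀, hp₀s⟩)
  -- The disc is contractible and locally path connected, so its parametrization lifts; the lift is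
  -- a section of `f` over the cap, started at `p₀`.
  obtain ⟨G, ⟨hGa, hG⟩, -⟩ := hcov.existsUnique_continuousMap_lifts Φ' a₀ ⟨p₀, hp₀s⟩ ha₀.symm
  have hfG : ∀ x : K, f (G x) = Φ x := fun x =>
    congrArg (fun z : sphereSide r c v => (z : E3)) (congrFun hG x)
  have hGopen : IsOpenMap G := by
    have h1 : IsLocalHomeomorph (h.mapsTo.restrict ∘ G) := by
      rw [hG]; exact hΦ'homeo.isOpenEmbedding.isLocalHomeomorph
    exact (h1.of_comp hloc G.continuous).isOpenMap
  have hsphere : ∀ x : K, inner ℝ v (f (G x) - c) = 0 ↔ (x : E2) ∈ Metric.sphere 0 R := fun x => by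
    rw [hfG]; exact hΦs x
  have hsub : Metric.sphere (0 : E2) R ⊆ K := Metric.sphere_subset_closedBall
  -- Along the lifted circle the height is `0`, while near a point of `B` in the side all points off
  -- `B` have positive height. So membership in `B` is open as well as closed, and it holds at `a₀`.
  have hbd : ∀ x : K, (x : E2) ∈ Metric.sphere 0 R → (G x : M) ∈ B := by
    have hcs : IsPreconnected (Metric.sphere (0 : E2) R) :=
      isPreconnected_sphere (by
        rw [← Module.finrank_eq_rank, finrank_euclideanSpace_fin]; norm_num) 0 R
    have : PreconnectedSpace (Metric.sphere (0 : E2) R) :=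
      isPreconnected_iff_preconnectedSpace.1 hcs
    set G' : Metric.sphere (0 : E2) R → M := fun x => G (inclusion hsub x) with hG'
    have hG'c : Continuous G' :=
      continuous_subtype_val.comp (G.continuous.comp (continuous_inclusion hsub))
    have hclopen : IsClopen (G' ⁻¹' B) := by
      refine ⟨h.isClosed.preimage hG'c, isOpen_iff_mem_nhds.2 fun x hx => ?_⟩
      have h1 := (h.boundary_side hx (G (inclusion hsub x)).2).1
      filter_upwards [hG'c.continuousAt.eventually h1] with x' hx'
      by_contra hxB
      have h2 := hx' hxB
      have h3 := (hsphere (inclusion hsub x')).2 x'.2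
      exact h2.ne' h3
    have ha₀s : (a₀ : E2) ∈ Metric.sphere 0 R := by
      rw [← hsphere, hGa]
      exact h.plane p₀ hp₀
    have huniv := hclopen.eq_univ ⟨⟨a₀, ha₀s⟩, by
      change ((G (inclusion hsub ⟨a₀, ha₀s⟩) : side f c v) : M) ∈ B
      have : inclusion hsub ⟨a₀, ha₀s⟩ = a₀ := rfl
      rw [this, hGa]
      exact hp₀⟩
    intro x hx
    exact (eq_univ_iff_forall.1 huniv) ⟨x, hx⟩
  set Z : Set M := range fun x : K => (G x : M) with hZ
  have hZclopen : IsClopen Z := by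
    refine ⟨(isCompact_range (continuous_subtype_val.comp G.continuous)).isClosed,
      isOpen_iff_mem_nhds.2 ?_⟩
    rintro _ ⟨x, rfl⟩
    have h1 : range G ∈ 𝓝 (G x) := hGopen.isOpen_range.mem_nhds ⟨x, rfl⟩
    rw [mem_nhds_subtype_iff_nhdsWithin] at h1
    have h2 : Subtype.val '' range G = Z := by rw [hZ, ← range_comp]; rfl
    rw [h2] at h1
    -- `range G` is open only relative to the side; the side is itself a neighbourhood of each point
    -- of it, so the image is open in `M`.
    have h3 : side f c v ∈ 𝓝 (G x : M) := by
      by_cases hx : (x : E2) ∈ Metric.sphere 0 R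
      · exact h.side_mem_nhds (hbd x hx) (G x).2
      · have h4 : 0 < inner ℝ v (f (G x) - c) :=
          lt_of_le_of_ne (h.mapsTo (G x).2).2 fun h0 => hx ((hsphere x).1 h0.symm)
        exact mem_of_superset ((isOpen_lt continuous_const h.continuous_height).mem_nhds h4)
          subset_closure
    rwa [nhdsWithin_eq_nhds.2 h3] at h1
  have hZuniv := eq_univ_iff_forall.1 (hZclopen.eq_univ ⟨_, a₀, rfl⟩)
  constructor
  · intro q q' hqq
    obtain ⟨x, rfl⟩ := hZuniv q
    obtain ⟨x', rfl⟩ := hZuniv q'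
    simp only [hfG] at hqq
    rw [Subtype.ext (hΦi hqq)]
  · refine Subset.antisymm ?_ fun y hy => ?_
    · rintro _ ⟨q, rfl⟩
      obtain ⟨x, rfl⟩ := hZuniv q
      exact h.mapsTo (G x).2
    · obtain ⟨x, hx, rfl⟩ := hΦim.superset hy
      exact ⟨G ⟨x, hx⟩, hfG ⟨x, hx⟩⟩

/-- A compact connected surface with boundary immersed in a sphere, whose boundary lies on a
circle, is one of the two caps. -/
theorem injective_and_range [CompactSpace M] [T2Space M] [PreconnectedSpace M]
    (h : IsSphericalDomain f B r c v) (hB : B.Nonempty) :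
    Function.Injective f ∧ ∃ w, (w = v ∨ w = -v) ∧ range f = sphereSide r c w := by
  obtain ⟨p₀, hp₀⟩ := hB
  obtain ⟨w, rfl | rfl, -, h1⟩ := h.boundary p₀ hp₀
  · have := h.injective_and_range_of_mem hp₀ (h.mem_side_of_le_map h1 (h.plane _ hp₀))
    exact ⟨this.1, w, Or.inl rfl, this.2⟩
  · have := h.neg.injective_and_range_of_mem hp₀ (h.neg.mem_side_of_le_map h1 (h.neg.plane _ hp₀))
    exact ⟨this.1, -v, Or.inr rfl, this.2⟩

end IsSphericalDomain

/-! ### Compact stationary surfaces spanning a circle -/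

lemma exists_orthonormalBasis_of_ne_zero {v : E3} (hv : v ≠ 0) :
    ∃ b : OrthonormalBasis (Fin 3) ℝ E3, ‖v‖ • b 0 = v := by
  have h1 : Orthonormal ℝ (({0} : Set (Fin 3)).domRestrict fun _ => (‖v‖⁻¹ • v : E3)) := by
    refine ⟨fun _ => norm_smul_inv_norm hv, fun i j hij => (hij (Subsingleton.elim i j)).elim⟩
  obtain ⟨b, hb⟩ := h1.exists_orthonormalBasis_extension_of_card_eq (by simp)
  refine ⟨b, ?_⟩
  rw [hb 0 rfl, smul_smul, mul_inv_cancel₀ (norm_ne_zero_iff.2 hv), one_smul]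

/-- A circle on a sphere with centre `0` is the intersection of the sphere with a plane which cuts
its interior. -/
lemma IsCircle.exists_eq_inter {Γ : Set E3} (hΓ : IsCircle Γ) {r : ℝ} (hr : 0 < r)
    (hΓr : Γ ⊆ Metric.sphere 0 r) : Γ.Nontrivial ∧ ∃ c v : E3, ‖c‖ < r ∧ v ≠ 0 ∧
      Γ = {x | x ∈ Metric.sphere (0 : E3) r ∧ inner ℝ v (x - c) = 0} := by
  obtain ⟨c, v, ρ, hv, hρ, rfl⟩ := hΓ
  obtain ⟨b, hb⟩ := exists_orthonormalBasis_of_ne_zero hv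
  have hvb : ∀ i : Fin 3, i ≠ 0 → inner ℝ v (b i) = 0 := fun i hi => by
    rw [← hb, inner_smul_left, inner_basis, if_neg hi.symm, mul_zero]
  have hmem : ∀ i : Fin 3, i ≠ 0 → ∀ s : ℝ, |s| = ρ →
      c + s • b i ∈ {x | dist x c = ρ ∧ inner ℝ v (x - c) = 0} := fun i hi s hs => by
    refine ⟨?_, ?_⟩
    · rw [dist_eq_norm, add_sub_cancel_left, norm_smul, b.orthonormal.1, mul_one, Real.norm_eq_abs,
        hs]
    · rw [add_sub_cancel_left, inner_smul_right, hvb i hi, mul_zero]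
  have hsq : ∀ i : Fin 3, i ≠ 0 → ∀ s : ℝ, |s| = ρ →
      ‖c‖ ^ 2 + 2 * (s * inner ℝ c (b i)) + ρ ^ 2 = r ^ 2 := fun i hi s hs => by
    have h1 : ‖c + s • b i‖ = r := by simpa using hΓr (hmem i hi s hs)
    rw [← h1, norm_add_sq_real, inner_smul_right, norm_smul, b.orthonormal.1, mul_one,
      Real.norm_eq_abs, hs]
  -- Antipodal points of the circle have equal norms, which forces `c` to be orthogonal to the plane
  -- of the circle. Pythagoras then gives `‖c‖ < r` and recovers the circle from the plane.
  have hcb : ∀ i : Fin 3, i ≠ 0 → inner ℝ c (b i) = 0 := fun i hi => by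
    have h1 := hsq i hi ρ (abs_of_pos hρ)
    have h2 := hsq i hi (-ρ) (by rw [abs_neg, abs_of_pos hρ])
    have h3 : ρ * inner ℝ c (b i) = 0 := by linarith
    exact (mul_eq_zero.1 h3).resolve_left hρ.ne'
  have hnorm : ‖c‖ ^ 2 + ρ ^ 2 = r ^ 2 := by
    have := hsq 1 (by decide) ρ (abs_of_pos hρ)
    rw [hcb 1 (by decide)] at this
    linarith
  have hc : c = inner ℝ (b 0) c • b 0 := by
    conv_lhs => rw [← b.sum_repr' c, Fin.sum_univ_three]
    rw [real_inner_comm c (b 1), real_inner_comm c (b 2), hcb 1 (by decide), hcb 2 (by decide)]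
    simp
  refine ⟨⟨_, hmem 1 (by decide) ρ (abs_of_pos hρ), _, hmem 1 (by decide) (-ρ)
    (by rw [abs_neg, abs_of_pos hρ]), fun h => ?_⟩, c, v, ?_, hv, ?_⟩
  · have h1 : ρ • b 1 = (-ρ) • b 1 := add_left_cancel h
    have h2 := congrArg (fun y => inner ℝ (b 1) y) h1
    simp only [inner_smul_right, inner_basis, if_true] at h2
    linarith
  · nlinarith [norm_nonneg c]
  · ext x
    refine ⟨fun hx => ⟨hΓr hx, hx.2⟩, fun ⟨hx, hx'⟩ => ⟨?_, hx'⟩⟩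
    have hxr : ‖x‖ = r := by simpa using hx
    have h0 : inner ℝ c (x - c) = 0 := by
      have h1 : ‖v‖ * inner ℝ (b 0) (x - c) = 0 := by
        rw [← hx']
        conv_rhs => rw [← hb, inner_smul_left]
        rfl
      have h2 := (mul_eq_zero.1 h1).resolve_left (norm_ne_zero_iff.2 hv)
      conv_lhs => rw [hc, inner_smul_left]
      rw [← hc, h2, mul_zero]
    have h3 : dist x c ^ 2 = ρ ^ 2 := by
      have h4 : x = c + (x - c) := by abel
      have h5 : ‖x‖ ^ 2 = ‖c‖ ^ 2 + ‖x - c‖ ^ 2 := by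
        conv_lhs => rw [h4, norm_add_sq_real, h0]
        ring
      rw [dist_eq_norm]
      rw [hxr] at h5
      linarith
    exact (sq_eq_sq₀ dist_nonneg hρ.le).1 h3

/-- A compact `-2`-stationary surface spanning a circle on a sphere with centre `0` is embedded
onto one of the two caps. -/
theorem IsCompactStationary.injective_and_isSphericalCap {M : Type*} [TopologicalSpace M]
    [ChartedSpace (EuclideanHalfSpace 2) M] {f : M → E3} (h : IsCompactStationary (-2) f)
    {Γ : Set E3} (hs : Spans f Γ) (hΓ : IsCircle Γ) {r : ℝ} (hr : 0 < r)
    (hΓr : Γ ⊆ Metric.sphere 0 r) : Function.Injective f ∧ IsSphericalCap r Γ (range f) := by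
  obtain ⟨hΓn, c, v, hc, hv, hΓeq⟩ := hΓ.exists_eq_inter hr hΓr
  have hM := h.isManifold
  have := h.t2Space
  have := h.compactSpace
  have := h.connectedSpace
  have hmem : ∀ p ∈ (𝓡∂ 2).boundary M, f p ∈ Γ := fun p hp => hs ▸ mem_image_of_mem f hp
  have hne : ((𝓡∂ 2).boundary M).Nonempty := by
    obtain ⟨y, hy⟩ := hΓn.nonempty
    rw [← hs] at hy
    exact hy.imp fun _ h => h.1
  have hb : ∀ p ∈ (𝓡∂ 2).boundary M, inner ℝ v (f p - c) = 0 := fun p hp => by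
    have := hmem p hp
    rw [hΓeq] at this
    exact this.2
  have hnorm := h.norm_eq hr hne fun p hp => by simpa using hΓr (hmem p hp)
  have hdom : IsSphericalDomain f ((𝓡∂ 2).boundary M) r c v := {
    norm_lt := hc
    ne_zero := hv
    continuous := h.smooth.continuous
    isClosed := (𝓡∂ 2).isClosed_boundary (n := ∞) (by simp)
    norm_eq := hnorm
    injOn := fun p => by
      obtain ⟨φ, ψ, g, A, hloc⟩ := h.exists_isLocalModel hnorm p
      exact hloc.exists_injOn
    interior := fun p hp => by
      obtain ⟨φ, ψ, g, A, hloc⟩ := h.exists_isLocalModel hnorm p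
      exact hloc.nhdsWithin_sphere_le_map hnorm hc hp
    plane := hb
    boundary := fun p hp => by
      obtain ⟨φ, ψ, g, A, hloc⟩ := h.exists_isLocalModel hnorm p
      exact hloc.one_sided hnorm hc hv hp hb }
  obtain ⟨hinj, w, hw, hrange⟩ := hdom.injective_and_range hne
  refine ⟨hinj, w, inner ℝ w c, ?_, ?_, ?_⟩
  · rcases hw with rfl | rfl
    · exact hv
    · exact neg_ne_zero.2 hv
  · rw [hΓeq]
    ext x
    refine and_congr_right fun _ => ?_
    rcases hw with rfl | rfl
    · rw [inner_sub_right, sub_eq_zero]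
    · rw [inner_sub_right, sub_eq_zero, inner_neg_left, inner_neg_left, neg_inj]
  · rw [hrange]
    ext x
    refine and_congr_right fun _ => ?_
    rw [mem_ofPred_eq, inner_sub_right, sub_nonneg]

/-! ### Immersions into a sphere are stationary -/

/-- `Y`, `A`, `B` span the space, and `ν` minus its projection to the line of `Y` is orthogonal to
all three. -/
lemma smul_of_inner_eq_zero {A B Y ν : E3} (hAB : LinearIndependent ℝ ![A, B]) (hY : Y ≠ 0)
    (hYA : inner ℝ Y A = 0) (hYB : inner ℝ Y B = 0) (hA : inner ℝ ν A = 0)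
    (hB : inner ℝ ν B = 0) : ν = (inner ℝ ν Y / ‖Y‖ ^ 2) • Y := by
  have hYn : ‖Y‖ ≠ 0 := norm_ne_zero_iff.2 hY
  have hli : LinearIndependent ℝ ![Y, A, B] := by
    refine linearIndependent_finCons.2 ⟨hAB, fun hmem => hY ?_⟩
    have hle : Submodule.span ℝ (range ![A, B]) ≤ (ℝ ∙ Y)ᗮ := by
      rw [Submodule.span_le]
      rintro _ ⟨i, rfl⟩
      rw [SetLike.mem_coe, Submodule.mem_orthogonal_singleton_iff_inner_right]
      fin_cases i
      · exact hYA
      · exact hYB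
    have := Submodule.mem_orthogonal_singleton_iff_inner_right.1 (hle hmem)
    exact inner_self_eq_zero.1 this
  have htop : Submodule.span ℝ (range ![Y, A, B]) = ⊤ :=
    hli.span_eq_top_of_card_eq_finrank (by simp)
  rw [← sub_eq_zero]
  set w := ν - (inner ℝ ν Y / ‖Y‖ ^ 2) • Y with hw
  have hle : (⊤ : Submodule ℝ E3) ≤ (ℝ ∙ w)ᗮ := by
    rw [← htop, Submodule.span_le]
    rintro _ ⟨i, rfl⟩
    rw [SetLike.mem_coe, Submodule.mem_orthogonal_singleton_iff_inner_right, hw, inner_sub_left,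
      inner_smul_left]
    fin_cases i
    · change inner ℝ ν Y - _ * inner ℝ Y Y = 0
      rw [real_inner_self_eq_norm_sq, conj_trivial, div_mul_cancel₀ _ (by positivity), sub_self]
    · change inner ℝ ν A - _ * inner ℝ Y A = 0
      rw [hA, hYA, mul_zero, sub_zero]
    · change inner ℝ ν B - _ * inner ℝ Y B = 0
      rw [hB, hYB, mul_zero, sub_zero]
  exact inner_self_eq_zero.1
    (Submodule.mem_orthogonal_singleton_iff_inner_right.1 (hle (Submodule.mem_top (x := w))))

/-- On a surface in a sphere with centre `0`, the second fundamental form with respect to the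
position vector is the opposite of the first. -/
lemma inner_pderiv_pderiv {X : E2 → E3} {T : Set E2} {x : E2} {r : ℝ}
    (hX : ∀ y ∈ T, ContDiffWithinAt ℝ ∞ X halfPlane y) (hTH : T ⊆ halfPlane)
    (hT : ∀ y ∈ T, T ∈ 𝓝[halfPlane] y) (hr : ∀ y ∈ T, ‖X y‖ = r) (hx : x ∈ T) (i j : Fin 2) :
    inner ℝ (pderiv halfPlane (pderiv halfPlane X i) j x) (X x) = -firstForm halfPlane X i j x := by
  have h0 : ∀ y ∈ T, inner ℝ (X y) (pderiv halfPlane X i y) = 0 := fun y hy =>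
    inner_fderivWithin_eq_zero ((hX y hy).differentiableWithinAt (by simp)) (hTH hy) (hT y hy) hr _
  have h1 := ((hX x hx).differentiableWithinAt (by simp)).hasFDerivWithinAt.inner ℝ
    ((contDiffWithinAt_pderiv (hX x hx) (hTH hx) i).differentiableWithinAt
      (by simp)).hasFDerivWithinAt
  have h2 : HasFDerivWithinAt (fun y => inner ℝ (X y) (pderiv halfPlane X i y)) (0 : E2 →L[ℝ] ℝ)
      halfPlane x := by
    refine (hasFDerivWithinAt_const 0 x halfPlane).congr_of_eventuallyEq ?_ (h0 x hx)
    filter_upwards [hT x hx] with y hy using h0 y hy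
  have h3 := congrArg (fun L => L (EuclideanSpace.single j 1))
    ((uniqueDiffOn_halfPlane x (hTH hx)).eq h1 h2)
  simp only [ContinuousLinearMap.comp_apply, ContinuousLinearMap.prod_apply, fderivInnerCLM_apply,
    zero_apply] at h3
  rw [firstForm, real_inner_comm, real_inner_comm (pderiv halfPlane X j x)]
  simp only [pderiv] at h3 ⊢
  linarith

section OfNormEq

variable {M : Type*} [TopologicalSpace M] [ChartedSpace (EuclideanHalfSpace 2) M] {f : M → E3}

/-- The normal is `s X`, so the second fundamental form is `-s` times the first and has trace `-2s`.
-/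
lemma meanCurvature_of_norm_eq (hf : ContMDiff (𝓡∂ 2) 𝓘(ℝ, E3) ∞ f)
    (hi : ∀ p : M, Function.Injective (mfderiv (𝓡∂ 2) 𝓘(ℝ, E3) f p)) {r : ℝ} (hr : 0 < r)
    (hfr : ∀ p, ‖f p‖ = r) {e : OpenPartialHomeomorph M (EuclideanHalfSpace 2)}
    (he : e ∈ IsManifold.maximalAtlas (𝓡∂ 2) ∞ M) {x : E2} (hx : x ∈ (e.extend (𝓡∂ 2)).target)
    {ν : E3} (hν : ∀ i : Fin 2, inner ℝ ν (pderiv halfPlane (localParam f e) i x) = 0) :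
    meanCurvature halfPlane (localParam f e) ν x =
      (-2) * (inner ℝ ν (localParam f e x) / ‖localParam f e x‖ ^ 2) := by
  set X := localParam f e with hX
  have hXd : ∀ y ∈ (e.extend (𝓡∂ 2)).target, ContDiffWithinAt ℝ ∞ X halfPlane y := fun y hy =>
    contDiffWithinAt_comp_extend_symm hf he hy
  have hinj : Function.Injective (fderivWithin ℝ X halfPlane x) :=
    injective_fderivWithin_comp_extend_symm hf hi he hx
  have hTH : (e.extend (𝓡∂ 2)).target ⊆ halfPlane := e.extend_target_subset_range
  have hT : ∀ y ∈ (e.extend (𝓡∂ 2)).target, (e.extend (𝓡∂ 2)).target ∈ 𝓝[halfPlane] y :=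
    fun y hy => extend_target_mem_nhdsWithin' hy
  have hXr : ∀ y, ‖X y‖ = r := fun y => hfr _
  have hX0 : X x ≠ 0 := norm_pos_iff.1 (by rw [hXr]; exact hr)
  have hXi : ∀ i, inner ℝ (X x) (pderiv halfPlane X i x) = 0 := fun i =>
    inner_fderivWithin_eq_zero ((hXd x hx).differentiableWithinAt (by simp)) (hTH hx) (hT x hx)
      (fun y _ => hXr y) _
  set s := inner ℝ ν (X x) / ‖X x‖ ^ 2 with hs
  have hνX : ν = s • X x :=
    smul_of_inner_eq_zero (linearIndependent_pderiv hinj) hX0 (hXi 0) (hXi 1) (hν 0) (hν 1)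
  have h2 : ∀ i j, secondForm halfPlane X ν i j x = -s * firstForm halfPlane X i j x := by
    intro i j
    rw [secondForm, hνX, inner_smul_right,
      inner_pderiv_pderiv hXd hTH hT (fun y _ => hXr y) hx]
    ring
  have hdet := firstForm_det_pos hinj
  rw [meanCurvature, h2, h2, h2, div_eq_iff hdet.ne']
  ring

end OfNormEq

section Immersion

variable {E H F : Type*} [NormedAddCommGroup E] [NormedSpace ℝ E] [TopologicalSpace H]
  [NormedAddCommGroup F] [NormedSpace ℝ F] {I : ModelWithCorners ℝ E H}
  {M : Type*} [TopologicalSpace M] [ChartedSpace H M] {f : M → F}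

lemma contMDiff_of_eventuallyEq_comp_extChartAt
    (h : ∀ p, ∃ g : E → F, ContDiff ℝ ∞ g ∧ f =ᶠ[𝓝 p] g ∘ extChartAt I p) :
    ContMDiff I 𝓘(ℝ, F) ∞ f := by
  intro p
  obtain ⟨g, hg, hfg⟩ := h p
  exact (hg.contMDiff.contMDiffAt.comp p contMDiffAt_extChartAt).congr_of_eventuallyEq hfg

/-- Near `p` the chart factors through `f`, and the derivative of the chart is invertible. -/
lemma injective_mfderiv_of_comp_eventuallyEq_extChartAt [IsManifold I ∞ M] {p : M}
    (hf : ContMDiff I 𝓘(ℝ, F) ∞ f)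
    {k : F → E} (hk : DifferentiableAt ℝ k (f p)) (h : k ∘ f =ᶠ[𝓝 p] extChartAt I p) :
    Function.Injective (mfderiv I 𝓘(ℝ, F) f p) := by
  have : IsManifold I 1 M := .of_le (n := ∞) (by simp)
  have h1 : mfderiv I 𝓘(ℝ, E) (k ∘ f) p =
      (mfderiv 𝓘(ℝ, F) 𝓘(ℝ, E) k (f p)).comp (mfderiv I 𝓘(ℝ, F) f p) :=
    mfderiv_comp p hk.mdifferentiableAt ((hf p).mdifferentiableAt (by simp))
  have h2 : Function.Injective (mfderiv I 𝓘(ℝ, E) (k ∘ f) p) := by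
    rw [h.mfderiv_eq]
    exact (isInvertible_mfderiv_extChartAt (mem_extChartAt_source p)).injective
  rw [h1] at h2
  exact Function.Injective.of_comp h2

end Immersion

/-! ### Spherical caps as surfaces with boundary -/

/-- The part of the sphere of radius `r` and centre `0` where `⟨v, x⟩ ≥ d`. -/
def cap (r : ℝ) (v : E3) (d : ℝ) : Set E3 :=
  {x | x ∈ Metric.sphere (0 : E3) r ∧ d ≤ inner ℝ v x}

lemma compactSpace_cap (r : ℝ) (v : E3) (d : ℝ) : CompactSpace (cap r v d) := by
  refine isCompact_iff_compactSpace.1 ?_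
  exact (isCompact_sphere (0 : E3) r).inter_right
    (isClosed_le continuous_const (by fun_prop : Continuous fun x : E3 => inner ℝ v x))

/-- A stereographic parametrization, for which a cap corresponds to the half plane. -/
structure CapCoordinates (r : ℝ) (v : E3) (d : ℝ) where
  /-- The frame, whose first vector points to the pole. -/
  frame : OrthonormalBasis (Fin 3) ℝ E3
  /-- The translation of the parameters. -/
  shift : ℝ
  pos : 0 < r
  nonneg_iff : ∀ x, 0 ≤ x 0 ↔ d ≤ inner ℝ v (stereo frame r shift x)
  zero_iff : ∀ x, x 0 = 0 ↔ inner ℝ v (stereo frame r shift x) = d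

/-- With the pole `q` on the bounding plane, the plane projects to a line and the cap to a half
plane. The second point `q'` rules out tangency of the plane at `q`, which would leave no such line.
-/
lemma exists_capCoordinates {r : ℝ} (hr : 0 < r) {v q : E3} (hq : ‖q‖ = r) {q' : E3}
    (hq' : ‖q'‖ = r) (hne : q' ≠ q) (hd : inner ℝ v q' = inner ℝ v q) (hv : v ≠ 0) :
    ∃ Z : CapCoordinates r v (inner ℝ v q), r • Z.frame 0 = q := by
  obtain ⟨u, hu⟩ : ∃ u : E3, u = r⁻¹ • q := ⟨_, rfl⟩
  have hru : r • u = q := by rw [hu, smul_smul, mul_inv_cancel₀ hr.ne', one_smul]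
  have hu1 : ‖u‖ = 1 := by
    rw [hu, norm_smul, norm_inv, Real.norm_of_nonneg hr.le, hq, inv_mul_cancel₀ hr.ne']
  set α := inner ℝ v u with hα
  set w := v - α • u with hw
  have hvw : v = α • u + w := by rw [hw]; abel
  have hwu : inner ℝ w u = 0 := by
    rw [hw, inner_sub_left, inner_smul_left, real_inner_self_eq_norm_sq, hu1]; simp [hα]
  have hw0 : w ≠ 0 := by
    intro h0
    rw [h0, add_zero] at hvw
    have hα0 : α ≠ 0 := fun h => hv (by rw [hvw, h, zero_smul])
    have h1 : inner ℝ q q' = r ^ 2 := by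
      have h2 : inner ℝ u q' = inner ℝ u q := by
        have h3 : α * inner ℝ u q' = α * inner ℝ u q := by
          have h4 : ∀ y, inner ℝ v y = α * inner ℝ u y := fun y => by
            conv_lhs => rw [hvw]
            rw [inner_smul_left, conj_trivial]
          rw [← h4, ← h4, hd]
        exact mul_left_cancel₀ hα0 h3
      calc inner ℝ q q' = r * inner ℝ u q' := by rw [← real_inner_smul_left, hru]
        _ = inner ℝ q q := by rw [h2, ← real_inner_smul_left, hru]
        _ = r ^ 2 := by rw [real_inner_self_eq_norm_sq, hq]
    have h3 : ‖q' - q‖ ^ 2 = 0 := by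
      rw [norm_sub_sq_real, real_inner_comm, h1, hq, hq']; ring
    exact hne (sub_eq_zero.1 (norm_eq_zero.1 (pow_eq_zero_iff two_ne_zero |>.1 h3)))
  have hβ : 0 < ‖w‖ := norm_pos_iff.2 hw0
  -- The frame is chosen with `v` in the span of its first two vectors. The entry `0` is a filler,
  -- since only the indices `0` and `1` are prescribed.
  have horth : Orthonormal ℝ (({0, 1} : Set (Fin 3)).domRestrict ![u, ‖w‖⁻¹ • w, 0]) := by
    rw [orthonormal_iff_ite]
    rintro ⟨i, rfl | rfl⟩ ⟨j, rfl | rfl⟩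
    · simp [hu1]
    · simp [real_inner_smul_right, real_inner_comm w u, hwu, Subtype.ext_iff]
    · simp [real_inner_smul_left, hwu, Subtype.ext_iff]
    · simp [norm_smul, hβ.ne']
  obtain ⟨b, hb⟩ := horth.exists_orthonormalBasis_extension_of_card_eq (by simp)
  have hb0 : b 0 = u := hb 0 (by simp)
  have hb1 : b 1 = ‖w‖⁻¹ • w := hb 1 (by simp)
  have hvb : v = α • b 0 + ‖w‖ • b 1 := by
    rw [hb0, hb1, smul_smul, mul_inv_cancel₀ hβ.ne', one_smul]; exact hvw
  have h0 : inner ℝ v (b 0) = α := by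
    conv_lhs => rw [hvb]
    simp [inner_add_left, inner_smul_left]
  have h1 : inner ℝ v (b 1) = ‖w‖ := by
    conv_lhs => rw [hvb]
    simp [inner_add_left, inner_smul_left]
  have h2 : inner ℝ v (b 2) = 0 := by
    conv_lhs => rw [hvb]
    simp [inner_add_left, inner_smul_left]
  -- The shift cancels the constant term `-α / (2r)` of the affine numerator, moving the line to `x
  -- 0 = 0`.
  have key : ∀ x, inner ℝ v (stereo b r (α / (2 * r * ‖w‖)) x) - inner ℝ v q =
      ‖w‖ * x 0 / ‖stereoPlane b r (α / (2 * r * ‖w‖)) x‖ ^ 2 := by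
    intro x
    rw [← inner_sub_right, ← hru, ← hb0, inner_stereo_sub, h0, h1, h2]
    congr 1
    field_simp
    ring
  have hP := fun x => norm_sq_stereoPlane_pos (b := b) (a := α / (2 * r * ‖w‖)) hr x
  refine ⟨⟨b, α / (2 * r * ‖w‖), hr, fun x => ?_, fun x => ?_⟩, by rw [hb0, hru]⟩
  · rw [← sub_nonneg (b := inner ℝ v q), key, le_div_iff₀ (hP x), zero_mul,
      mul_nonneg_iff_of_pos_left hβ]
  · rw [← sub_eq_zero (b := inner ℝ v q), key, div_eq_zero_iff, or_iff_left (hP x).ne',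
      mul_eq_zero, or_iff_right hβ.ne']

namespace CapCoordinates

variable {r : ℝ} {v : E3} {d : ℝ} (Z : CapCoordinates r v d)

/-- The stereographic parametrization of the sphere. -/
noncomputable def param : E2 → E3 := stereo Z.frame r Z.shift

/-- The stereographic coordinates. -/
noncomputable def coord : E3 → E2 := stereoInv Z.frame r Z.shift

lemma coord_param (x : E2) : Z.coord (Z.param x) = x := stereoInv_stereo x

lemma param_coord {y : E3} (hy : ‖y‖ = r) (hne : y ≠ r • Z.frame 0) : Z.param (Z.coord y) = y :=
  stereo_stereoInv Z.pos hy hne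

lemma contDiff_param : ContDiff ℝ ∞ Z.param := contDiff_stereo _ _ _ Z.pos

lemma contDiffOn_coord : ContDiffOn ℝ ∞ Z.coord {r • Z.frame 0}ᶜ := contDiffOn_stereoInv _ _ _

lemma param_ne (x : E2) : Z.param x ≠ r • Z.frame 0 := stereo_ne Z.pos x

lemma param_mem_cap {x : E2} (hx : x ∈ halfPlane) : Z.param x ∈ cap r v d :=
  ⟨mem_sphere_zero_iff_norm.2 (norm_stereo Z.pos x), (Z.nonneg_iff x).1 (mem_halfPlane.1 hx)⟩

lemma norm_of_mem_cap {y : E3} (hy : y ∈ cap r v d) : ‖y‖ = r := by simpa using hy.1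

lemma coord_mem_halfPlane {y : E3} (hy : y ∈ cap r v d) (hne : y ≠ r • Z.frame 0) :
    Z.coord y ∈ halfPlane := by
  rw [mem_halfPlane, Z.nonneg_iff]
  exact hy.2.trans_eq (congrArg _ (Z.param_coord (norm_of_mem_cap hy) hne).symm)

/-- The chart of a cap given by stereographic coordinates. -/
noncomputable def chart : OpenPartialHomeomorph (cap r v d) (EuclideanHalfSpace 2) where
  toFun p := (𝓡∂ 2).symm (Z.coord p)
  invFun x := ⟨Z.param ((𝓡∂ 2) x), Z.param_mem_cap (mem_range_self x)⟩
  source := {p | (p : E3) ≠ r • Z.frame 0}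
  target := univ
  map_source' _ _ := mem_univ _
  map_target' _ _ := Z.param_ne _
  left_inv' p hp := by
    refine Subtype.ext ?_
    change Z.param ((𝓡∂ 2) ((𝓡∂ 2).symm (Z.coord p))) = p
    rw [(𝓡∂ 2).right_inv (Z.coord_mem_halfPlane p.2 hp),
      Z.param_coord (norm_of_mem_cap p.2) hp]
  right_inv' x _ := by
    change (𝓡∂ 2).symm (Z.coord (Z.param ((𝓡∂ 2) x))) = x
    rw [Z.coord_param, (𝓡∂ 2).left_inv]
  open_source := isOpen_ne.preimage continuous_subtype_val
  open_target := isOpen_univ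
  continuousOn_toFun := (𝓡∂ 2).continuous_symm.comp_continuousOn
    (Z.contDiffOn_coord.continuousOn.comp continuous_subtype_val.continuousOn fun _ hp => hp)
  continuousOn_invFun := ((Z.contDiff_param.continuous.comp (𝓡∂ 2).continuous).subtype_mk
    _).continuousOn

lemma mem_chart_source {p : cap r v d} : p ∈ Z.chart.source ↔ (p : E3) ≠ r • Z.frame 0 := Iff.rfl

lemma extend_chart_apply {p : cap r v d} (hp : p ∈ Z.chart.source) :
    Z.chart.extend (𝓡∂ 2) p = Z.coord p :=
  (𝓡∂ 2).right_inv (Z.coord_mem_halfPlane p.2 hp)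

lemma param_extend_chart {p : cap r v d} (hp : p ∈ Z.chart.source) :
    Z.param (Z.chart.extend (𝓡∂ 2) p) = p := by
  rw [Z.extend_chart_apply hp, Z.param_coord (norm_of_mem_cap p.2) hp]

lemma differentiableAt_coord {p : cap r v d} (hp : p ∈ Z.chart.source) :
    DifferentiableAt ℝ Z.coord p :=
  (Z.contDiffOn_coord.contDiffAt (isOpen_compl_singleton.mem_nhds hp)).differentiableAt (by simp)

end CapCoordinates

/-- A cap is covered by stereographic coordinates if there are at least two poles. -/
structure CapAtlas (r : ℝ) (v : E3) (d : ℝ) : Prop where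
  exists_ne : ∀ y : E3, ∃ Z : CapCoordinates r v d, y ≠ r • Z.frame 0

section Cap

variable {r : ℝ} {v : E3} {d : ℝ} [hA : Fact (CapAtlas r v d)]

noncomputable instance : ChartedSpace (EuclideanHalfSpace 2) (cap r v d) where
  atlas := range CapCoordinates.chart
  chartAt p := (hA.out.exists_ne p).choose.chart
  mem_chart_source p := (hA.out.exists_ne p).choose_spec
  chart_mem_atlas _ := mem_range_self _

instance : IsManifold (𝓡∂ 2) ∞ (cap r v d) := by
  refine isManifold_of_contDiffOn _ _ _ ?_
  rintro _ _ ⟨Z, rfl⟩ ⟨Z', rfl⟩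
  refine (Z'.contDiffOn_coord.comp (Z.contDiff_param.contDiffOn (s := (𝓡∂ 2).symm ⁻¹'
    (Z.chart.symm ≫ₕ Z'.chart).source ∩ range (𝓡∂ 2))) ?_).congr ?_
  · rintro x ⟨hx, hxr⟩
    have h1 : Z.param ((𝓡∂ 2) ((𝓡∂ 2).symm x)) ≠ r • Z'.frame 0 := hx.2
    rwa [(𝓡∂ 2).right_inv hxr] at h1
  · rintro x ⟨hx, hxr⟩
    refine (Z'.extend_chart_apply (p := Z.chart.symm ((𝓡∂ 2).symm x)) hx.2).trans ?_
    change Z'.coord (Z.param ((𝓡∂ 2) ((𝓡∂ 2).symm x))) = _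
    rw [(𝓡∂ 2).right_inv hxr]
    rfl

lemma chartAt_cap (p : cap r v d) :
    ∃ Z : CapCoordinates r v d, chartAt (EuclideanHalfSpace 2) p = Z.chart := ⟨_, rfl⟩

lemma contMDiff_cap_val :
    ContMDiff (𝓡∂ 2) 𝓘(ℝ, E3) ∞ (Subtype.val : cap r v d → E3) := by
  refine contMDiff_of_eventuallyEq_comp_extChartAt fun p => ?_
  obtain ⟨Z, hZ⟩ := chartAt_cap p
  refine ⟨Z.param, Z.contDiff_param, ?_⟩
  filter_upwards [(chartAt (EuclideanHalfSpace 2) p).open_source.mem_nhds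
    (ChartedSpace.mem_chart_source p)] with q hq
  rw [Function.comp_apply, extChartAt, hZ, Z.param_extend_chart (hZ ▸ hq)]

lemma injective_mfderiv_cap_val (p : cap r v d) :
    Function.Injective (mfderiv (𝓡∂ 2) 𝓘(ℝ, E3) (Subtype.val : cap r v d → E3) p) := by
  obtain ⟨Z, hZ⟩ := chartAt_cap p
  have hp := ChartedSpace.mem_chart_source (H := EuclideanHalfSpace 2) p
  refine injective_mfderiv_of_comp_eventuallyEq_extChartAt contMDiff_cap_val
    (k := Z.coord) (Z.differentiableAt_coord (hZ ▸ hp)) ?_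
  filter_upwards [(chartAt (EuclideanHalfSpace 2) p).open_source.mem_nhds hp] with q hq
  rw [Function.comp_apply, extChartAt, hZ, Z.extend_chart_apply (hZ ▸ hq)]

lemma mem_boundary_cap_iff {p : cap r v d} :
    p ∈ (𝓡∂ 2).boundary (cap r v d) ↔ inner ℝ v (p : E3) = d := by
  obtain ⟨Z, hZ⟩ := chartAt_cap p
  have hp : p ∈ Z.chart.source := hZ ▸ ChartedSpace.mem_chart_source p
  rw [mem_boundary_iff (e := Z.chart) (mem_range_self Z) hp, Z.zero_iff]
  change inner ℝ v (Z.param _) = d ↔ _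
  rw [Z.param_extend_chart hp]

/-- Two charts with distinct poles cover the cap, and each domain is a continuous image of a half
plane. They meet, because two different parameters of the first cannot both be sent to the pole of
the second. -/
lemma connectedSpace_cap : ConnectedSpace (cap r v d) := by
  obtain ⟨Z, -⟩ := hA.out.exists_ne 0
  obtain ⟨Z', hZ'⟩ := hA.out.exists_ne (r • Z.frame 0)
  have hpre : ∀ Z : CapCoordinates r v d, IsPreconnected Z.chart.source := fun Z => by
    rw [← Z.chart.symm_image_target_eq_source]
    exact isPreconnected_univ.image _ Z.chart.continuousOn_symm
  have hunion : Z.chart.source ∪ Z'.chart.source = univ := by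
    refine eq_univ_iff_forall.2 fun p => ?_
    by_cases hp : (p : E3) = r • Z.frame 0
    · exact Or.inr (Z'.mem_chart_source.2 (by rwa [hp]))
    · exact Or.inl hp
  have hinter : (Z.chart.source ∩ Z'.chart.source).Nonempty := by
    have h0 : (0 : E2) ∈ halfPlane := mem_halfPlane.2 (by simp)
    have h1 : (EuclideanSpace.single 0 1 : E2) ∈ halfPlane := mem_halfPlane.2 (by simp)
    by_cases h : Z.param 0 = r • Z'.frame 0
    · refine ⟨⟨_, Z.param_mem_cap h1⟩, Z.param_ne _, fun h' => ?_⟩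
      have h2 := congrArg Z.coord (h.trans (Eq.symm h'))
      rw [Z.coord_param, Z.coord_param] at h2
      simpa using congrArg (fun x : E2 => x 0) h2
    · exact ⟨⟨_, Z.param_mem_cap h0⟩, Z.param_ne _, h⟩
  have : PreconnectedSpace (cap r v d) :=
    ⟨hunion ▸ (hpre Z).union' hinter (hpre Z')⟩
  exact ⟨hinter.to_type⟩

lemma isCompactStationary_cap (hr : 0 < r) :
    IsCompactStationary (-2) (Subtype.val : cap r v d → E3) where
  isManifold := inferInstance
  t2Space := inferInstance
  compactSpace := compactSpace_cap r v d
  connectedSpace := connectedSpace_cap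
  smooth := contMDiff_cap_val
  immersion := injective_mfderiv_cap_val
  ne_zero p := norm_pos_iff.1 (by rw [CapCoordinates.norm_of_mem_cap p.2]; exact hr)
  stationary _ he _ hx _ _ hν := meanCurvature_of_norm_eq contMDiff_cap_val
    injective_mfderiv_cap_val hr (fun p => CapCoordinates.norm_of_mem_cap p.2) he hx hν

end Cap

/-- Each cap bounded by a circle is an embedded compact `-2`-stationary surface. -/
theorem IsSphericalCap.exists_isCompactStationary {r : ℝ} (hr : 0 < r) {Γ C : Set E3}
    (hΓ : Γ.Nontrivial) (hC : IsSphericalCap r Γ C) :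
    ∃ (M : Type) (_ : TopologicalSpace M) (_ : ChartedSpace (EuclideanHalfSpace 2) M)
      (f : M → E3), IsCompactStationary (-2) f ∧ Spans f Γ ∧ Function.Injective f ∧
        range f = C := by
  obtain ⟨v, d, hv, rfl, rfl⟩ := hC
  have : Fact (CapAtlas r v d) := ⟨⟨fun y => by
    -- The pole is a point of the circle other than `y`; a further point of the circle provides the
    -- nondegeneracy.
    obtain ⟨q, ⟨hq, hqd⟩, hqy⟩ := hΓ.exists_ne y
    obtain ⟨q', ⟨hq', hqd'⟩, hqq⟩ := hΓ.exists_ne q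
    subst hqd
    obtain ⟨Z, hZ⟩ := exists_capCoordinates hr (by simpa using hq) (by simpa using hq') hqq hqd' hv
    exact ⟨Z, by rw [hZ]; exact hqy.symm⟩⟩⟩
  refine ⟨cap r v d, inferInstance, inferInstance, Subtype.val, isCompactStationary_cap hr, ?_,
    Subtype.val_injective, Subtype.range_val⟩
  ext x
  constructor
  · rintro ⟨p, hp, rfl⟩
    exact ⟨p.2.1, mem_boundary_cap_iff.1 hp⟩
  · rintro ⟨hx, hxd⟩
    exact ⟨⟨x, hx, hxd.ge⟩, mem_boundary_cap_iff.2 hxd, rfl⟩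

end StationarySurface

theorem theoremt22 (r₀ : ℝ) (hr₀ : 0 < r₀) (Γ : Set StationarySurface.E3)
    (hΓ : StationarySurface.IsCircle Γ)
    (hΓr₀ : Γ ⊆ Metric.sphere (0 : StationarySurface.E3) r₀) :
    (∀ (M : Type*) [TopologicalSpace M] [ChartedSpace (EuclideanHalfSpace 2) M]
        (f : M → StationarySurface.E3),
        StationarySurface.IsCompactStationary (-2) f → StationarySurface.Spans f Γ →
          Function.Injective f ∧ StationarySurface.IsSphericalCap r₀ Γ (Set.range f)) ∧
      (∀ C : Set StationarySurface.E3, StationarySurface.IsSphericalCap r₀ Γ C →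
        ∃ (M : Type) (_ : TopologicalSpace M) (_ : ChartedSpace (EuclideanHalfSpace 2) M)
          (f : M → StationarySurface.E3),
          StationarySurface.IsCompactStationary (-2) f ∧ StationarySurface.Spans f Γ ∧
            Function.Injective f ∧ Set.range f = C) := by
  exact ⟨fun _ _ _ _ h hs => h.injective_and_isSphericalCap hs hΓ hr₀ hΓr₀,
    fun _ hC => hC.exists_isCompactStationary hr₀ (hΓ.exists_eq_inter hr₀ hΓr₀).1⟩
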